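/- **Setting.** Let $k\ge 1$, $p=r+q$, and consider the nonlinear VAR($k$) model in $\mathbb R^p$ $$f_0(z_t)=c+\sum_{i=1}^k f_i(z_{t-i})+u_t ,\qquad f_i:\mathbb R^p\to\mathbb R^p .$$ Put $g_j(z)=-\sum_{i=j+1}^k f_i(z)$, $\pi(z)=-f_0(z)+\sum_{i=1}^k f_i(z)$, $h(z)=f_0(z)-\sum_{i=1}^{k-1}g_i(z)$ and, for a state $\mathfrak z=(\mathfrak z_1,\dots,\mathfrak z_k)\in\mathbb R^{kp}$ (latest value first), $\bar h(\mathfrak z)=f_0(\mathfrak z_1)-\sum_{i=1}^{k-1}g_i(\mathfrak z_{i+1})$. Suppose the model belongs to the class $\mathcal M_r$: there are $\alpha\in\mathbb R^{p\times r}$ of rank $r$, $\bar b\in\mathbb R$ and $\bar\rho\in[0,1)$ such that * $f_0$ is a homeomorphism of $\mathbb R^p$; * $c=\alpha\mu$ and $\pi(z)=\alpha\theta(z)$ for all $z$, for some $\mu\in\mathbb R^r$ and $\theta:\mathbb R^p\to\mathbb R^r$; * there is a closed set $\mathcal B\subset\mathbb R^{kp\times[p(k-1)+r]}$ with $\|\boldsymbol\beta\|\le\bar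 b$ for all $\boldsymbol\beta\in\mathcal B$ (operator norm) and $\rho_{\mathrm{JSR}}(\{I+\boldsymbol\beta^{\mathsf T}\boldsymbol\alpha:\boldsymbol\beta\in\mathcal B\})\le\bar\rho$, such that for all $\boldsymbol z=(z,\zeta)$ and $\boldsymbol z'=(z',\zeta')$ in $\mathbb R^p\times\mathbb R^{p(k-1)}$ some $\boldsymbol\beta\in\mathcal B$ satisfies $G(\boldsymbol z)-G(\boldsymbol z')=\boldsymbol\beta^{\mathsf T}(\boldsymbol z-\boldsymbol z')$. Here $G(z,\zeta)=\big(\theta(f_0^{-1}(z)),\ (g_j(f_0^{-1}(z)))_{j=1}^{k-1}+D\zeta\big)$, $D$ is the $p(k-1)\times p(k-1)$ block matrix with $-I_p$ on the diagonal and $I_p$ on the superdiagonal, $\boldsymbol\alpha=\begin{bmatrix}\alpha&E^{\mathsf T}\\0&I\end{bmatrix}$ with $E^{\mathsf T}=[I_p,0,\dots,0]$, and $\rho_{\mathrm{JSR}}(\mathcal A)=\limsup_{t\to\infty}\sup_{B\in\mathcal A^t}\rho(B)^{1/t}$, where $\mathcal A^t$ is the set of $t$-fold products of members of $\mathcal A$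 and $\rho$ is the spectral radius. Let $\alpha_\perp$ be a $p\times q$ matrix of rank $q$ with $\alpha_\perp^{\mathsf T}\alpha=0$; let $\psi(z)=\alpha_\perp^{\mathsf T}h(z)$, $\chi(z)=(\psi(z),\theta(z))$, and let $\mathscr M_\mu=\{z:\pi(z)=-c\}$ be the set of steady states. For a state $\mathfrak z$ at date $\tau-1$ and a shock $u_\tau=u$, with $u_t=0$ for $t>\tau$, let $z_\infty(u;\mathfrak z)=\lim_{t\to\infty}z_t$. The long-run multiplier matrix at $\mathfrak z$ is the Jacobian of $u\mapsto z_\infty(u;\mathfrak z)$ at $u=0$; it exists if $z_\infty(u;\mathfrak z)$ exists for all $u$ and is differentiable in $u$ at $u=0$. Let $N$ be the set of $z\in\mathscr M_\mu$ at which $v\mapsto\chi^{-1}(\psi(z)+v,-\mu)$ is not differentiable at $v=0$, and $N_0$ the union of $N$ with the set of $z\in\mathscr M_\mu\setminus N$ at which the ($p\times q$) Jacobian of this map at $v=0$ is not injective. **Theorem (long-run multipliers).** The map $\chi$ is a homeomorphism of $\mathbb R^p$ onto $\mathbb R^q\times\mathbb R^r$, and: 1. For each state $\mathfrak z$ there is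 a $z\in\mathscr M_\mu$ with $\psi(z)=\alpha_\perp^{\mathsf T}\bar h(\mathfrak z)$ such that the long-run multiplier matrix at $\mathfrak z$ exists if and only if the one at the steady-state history $(z,\dots,z)$ does, and then the two are equal. For $z\in\mathscr M_\mu$, the one at $(z,\dots,z)$ exists if and only if $z\notin N$. Hence the full set of long-run multiplier matrices is $\{\Theta_\infty(z):z\in\mathscr M_\mu\setminus N\}$, where for $z\in\mathscr M_\mu\setminus N$ $$\Theta_\infty(z)=\partial_u\,\chi^{-1}\big(\psi(z)+\alpha_\perp^{\mathsf T}u,\,-\mu\big)\big|_{u=0}=\partial_v\,\chi^{-1}\big(\psi(z)+v,\,-\mu\big)\big|_{v=0}\,\alpha_\perp^{\mathsf T}$$ is the multiplier matrix at $(z,\dots,z)$, both derivatives existing. 2. $\operatorname{rk}\Theta_\infty(z)=q$ for every $z\in\mathscr M_\mu\setminus N_0$. -/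

import Mathlib

open Filter Topology
open scoped Matrix Pointwise

noncomputable section

/-- The joint spectral radius `limsup_{t → ∞} sup_{B ∈ 𝒜 ^ t} ρ(B) ^ (1 / t)` of a set `𝒜` of real
square matrices. Here `𝒜 ^ t` is the (pointwise) set of all `t`-fold products of members of `𝒜`
and `ρ(B)` is the spectral radius over `ℂ`. The value is an extended non-negative real number, so
no boundedness is needed for the suprema to be meaningful. -/
def jointSpectralRadius {m : Type*} [Fintype m] [DecidableEq m] (𝒜 : Set (Matrix m m ℝ)) :
    ENNReal :=
  limsup (fun t : ℕ ↦ ⨆ B ∈ 𝒜 ^ t,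
    spectralRadius ℂ (B.map (algebraMap ℝ ℂ)) ^ (1 / (t : ℝ))) atTop

/-- The operator norm of a real matrix induced by the Euclidean norms. -/
def matrixOpNorm {m n : Type*} [Fintype m] [Fintype n] [DecidableEq n] (A : Matrix m n ℝ) : ℝ :=
  ‖LinearMap.toContinuousLinearMap (Matrix.toEuclideanLin A)‖

/-- `αp` is a choice of `α_⊥`: a `p × q` matrix, `q = p - r`, of full column rank, whose columns
are orthogonal to those of the `p × r` matrix `α`. -/
structure IsPerp {p r q : ℕ} (α : Matrix (Fin p) (Fin r) ℝ) (αp : Matrix (Fin p) (Fin q) ℝ) :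
    Prop where
  dim : r + q = p
  rank_eq : αp.rank = q
  orthogonal : αpᵀ * α = 0

/-- The Jacobian matrix at `x` of a map between Euclidean spaces (meaningful where the map is
Fréchet differentiable). -/
def jacobian {m n : ℕ} (F : (Fin m → ℝ) → (Fin n → ℝ)) (x : Fin m → ℝ) :
    Matrix (Fin n) (Fin m) ℝ :=
  LinearMap.toMatrix' (fderiv ℝ F x : (Fin m → ℝ) →ₗ[ℝ] (Fin n → ℝ))

/-- The parameters `(c, f₀, …, f_k)` of an additively time-separable nonlinear VAR(`k`) in `ℝ^p`,
`f₀ (z_t) = c + ∑_{i=1}^k f_i (z_{t-i}) + u_t`. -/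
structure NonlinearVAR (p k : ℕ) where
  c : Fin p → ℝ
  f : Fin (k + 1) → (Fin p → ℝ) → (Fin p → ℝ)

namespace NonlinearVAR

variable {p k : ℕ} (M : NonlinearVAR p k)

/-- The model equation at date `t`, for the series `z` and the shocks `u`. -/
def FollowsAt (z u : ℤ → Fin p → ℝ) (t : ℤ) : Prop :=
  M.f 0 (z t) = M.c + ∑ i : Fin k, M.f i.succ (z (t - ((i : ℕ) + 1 : ℤ))) + u t

/-- `g_j (z) = - ∑_{i=j+1}^k f_i (z)`. -/
def g (j : ℕ) (z : Fin p → ℝ) : Fin p → ℝ :=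
  -∑ i ∈ Finset.univ.filter (fun i : Fin (k + 1) ↦ j < (i : ℕ)), M.f i z

/-- `π (z) = - f₀ (z) + ∑_{i=1}^k f_i (z)`. -/
def piMap (z : Fin p → ℝ) : Fin p → ℝ :=
  -M.f 0 z + ∑ i : Fin k, M.f i.succ z

/-! ### The class of cointegrated models

The companion vector `(z, ζ) ∈ ℝ^p × ℝ^{p(k-1)}` is indexed by `Fin p ⊕ (Fin (k - 1) × Fin p)`; a
pair `(j, a)` is coordinate `a` of the block `j + 1 ∈ {1, …, k - 1}`. -/

/-- The block matrix with `-I_p` on the diagonal and `I_p` on the superdiagonal. -/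
def D (p k : ℕ) : Matrix (Fin (k - 1) × Fin p) (Fin (k - 1) × Fin p) ℝ :=
  Matrix.of fun i j ↦
    if i.2 = j.2 then
      (if j.1 = i.1 then -1 else if (j.1 : ℕ) = (i.1 : ℕ) + 1 then 1 else 0)
    else 0

/-- The transpose of `E`, that is, the `p × p(k-1)` matrix `[I_p, 0, …, 0]`. -/
def ET (p k : ℕ) : Matrix (Fin p) (Fin (k - 1) × Fin p) ℝ :=
  Matrix.of fun a j ↦ if (j.1 : ℕ) = 0 ∧ a = j.2 then 1 else 0

/-- The matrix `[[0, 0], [0, D]]`. -/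
def D₀ (p k r : ℕ) :
    Matrix (Fin r ⊕ (Fin (k - 1) × Fin p)) (Fin p ⊕ (Fin (k - 1) × Fin p)) ℝ :=
  Matrix.fromBlocks 0 0 0 (D p k)

/-- The matrix `[[α, Eᵀ], [0, I]]`. -/
def boldAlpha (k : ℕ) {p r : ℕ} (α : Matrix (Fin p) (Fin r) ℝ) :
    Matrix (Fin p ⊕ (Fin (k - 1) × Fin p)) (Fin r ⊕ (Fin (k - 1) × Fin p)) ℝ :=
  Matrix.fromBlocks α (ET p k) 0 1

/-- The stacked vector `(θ (z), g₁ (z), …, g_{k-1} (z))`. -/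
def boldTheta {r : ℕ} (θ : (Fin p → ℝ) → (Fin r → ℝ)) (z : Fin p → ℝ) :
    Fin r ⊕ (Fin (k - 1) × Fin p) → ℝ :=
  Sum.elim (θ z) (fun j ↦ M.g ((j.1 : ℕ) + 1) z j.2)

/-- The map `(z, ζ) ↦ (𝛉 ∘ f₀⁻¹) (z) + 𝐃₀ (z, ζ)`. -/
def gradMap {r : ℕ} (θ : (Fin p → ℝ) → (Fin r → ℝ)) (w : Fin p ⊕ (Fin (k - 1) × Fin p) → ℝ) :
    Fin r ⊕ (Fin (k - 1) × Fin p) → ℝ :=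
  M.boldTheta θ (Function.invFun (M.f 0) (w ∘ Sum.inl)) + D₀ p k r *ᵥ w

/-- The model belongs to the class `ℳ_r(α, b, ρ)`, where `μ` and `θ` are the vector and the map
for which `c = α μ` and `π = α θ` (they are unique, since `α` has full column rank). -/
structure MemClass {r : ℕ} (α : Matrix (Fin p) (Fin r) ℝ) (b ρ : ℝ)
    (μ : Fin r → ℝ) (θ : (Fin p → ℝ) → (Fin r → ℝ)) : Prop where
  rank_eq : α.rank = r
  nonneg : 0 ≤ ρ
  lt_one : ρ < 1
  homeo : IsHomeomorph (M.f 0)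
  const_eq : M.c = α *ᵥ μ
  pi_eq : ∀ z, M.piMap z = α *ᵥ θ z
  exists_jsr_le :
    ∃ ℬ : Set (Matrix (Fin p ⊕ (Fin (k - 1) × Fin p)) (Fin r ⊕ (Fin (k - 1) × Fin p)) ℝ),
      IsClosed ℬ ∧ (∀ β ∈ ℬ, matrixOpNorm β ≤ b) ∧
      jointSpectralRadius ((fun β ↦ 1 + βᵀ * boldAlpha k α) '' ℬ) ≤ ENNReal.ofReal ρ ∧
      ∀ w w', ∃ β ∈ ℬ, M.gradMap θ w - M.gradMap θ w' = βᵀ *ᵥ (w - w')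

/-! ### Common trends, steady states and long-run responses -/

/-- `h (z) = f₀ (z) - ∑_{i=1}^{k-1} g_i (z)`. -/
def h (z : Fin p → ℝ) : Fin p → ℝ :=
  M.f 0 z - ∑ i : Fin (k - 1), M.g ((i : ℕ) + 1) z

/-- `h̄ (s₁, …, s_k) = f₀ (s₁) - ∑_{i=1}^{k-1} g_i (s_{i+1})`. A state `s : Fin k → ℝ^p` lists
the most recent values, latest first, so that `s i` is the `(i+1)`-th of them. -/
def hBar [NeZero k] (s : Fin k → Fin p → ℝ) : Fin p → ℝ :=
  M.f 0 (s 0) - ∑ i : Fin (k - 1), M.g ((i : ℕ) + 1) (s ⟨(i : ℕ) + 1, by omega⟩)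

/-- `ψ (z) = α_⊥ᵀ h (z)`. -/
def psi {q : ℕ} (αp : Matrix (Fin p) (Fin q) ℝ) (z : Fin p → ℝ) : Fin q → ℝ :=
  αpᵀ *ᵥ M.h z

/-- `χ (z) = (ψ (z), θ (z))`. -/
def chi {q r : ℕ} (αp : Matrix (Fin p) (Fin q) ℝ) (θ : (Fin p → ℝ) → (Fin r → ℝ))
    (z : Fin p → ℝ) : (Fin q → ℝ) × (Fin r → ℝ) :=
  (M.psi αp z, θ z)

/-- `χ⁻¹`. -/
def chiInv {q r : ℕ} (αp : Matrix (Fin p) (Fin q) ℝ) (θ : (Fin p → ℝ) → (Fin r → ℝ)) :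
    (Fin q → ℝ) × (Fin r → ℝ) → (Fin p → ℝ) :=
  Function.invFun (M.chi αp θ)

/-- The set of steady state equilibria `{z | π (z) = -c}`. -/
def steadyStates : Set (Fin p → ℝ) := {z | M.piMap z = -M.c}

/-- `z` is a path of the model which is in state `s` at date `τ - 1`, is hit by the shock `u` at
date `τ`, and by no further shock after that. -/
structure IsResponsePath (s : Fin k → Fin p → ℝ) (τ : ℤ) (u : Fin p → ℝ) (z : ℤ → Fin p → ℝ) :
    Prop where
  init : ∀ i : Fin k, z (τ - ((i : ℕ) + 1 : ℤ)) = s i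
  follows : ∀ t, τ ≤ t → M.FollowsAt z (Pi.single τ u) t

/-- `zInf u` is the limit, as `t → ∞`, of the response to a last shock `u` from the state `s`,
for each `u`, whatever the date of the shock. -/
def IsLongRunResponse (s : Fin k → Fin p → ℝ) (zInf : (Fin p → ℝ) → (Fin p → ℝ)) : Prop :=
  ∀ (u : Fin p → ℝ) (τ : ℤ), (∃ z, M.IsResponsePath s τ u z) ∧
    ∀ z, M.IsResponsePath s τ u z → Tendsto z atTop (𝓝 (zInf u))

/-- The long-run multiplier matrix at the state `s` exists and equals `Θ`: the long-run response
exists, and is differentiable in the shock `u` at `u = 0` with Jacobian matrix `Θ`. -/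
def HasLongRunMultiplier (s : Fin k → Fin p → ℝ) (Θ : Matrix (Fin p) (Fin p) ℝ) : Prop :=
  ∃ zInf : (Fin p → ℝ) → (Fin p → ℝ), M.IsLongRunResponse s zInf ∧
    HasFDerivAt zInf (LinearMap.toContinuousLinearMap (Matrix.toLin' Θ)) 0

section Multipliers

variable {q r : ℕ} (αp : Matrix (Fin p) (Fin q) ℝ) (μ : Fin r → ℝ)
  (θ : (Fin p → ℝ) → (Fin r → ℝ))

/-- The map `v ↦ χ⁻¹ (ψ (z) + v, -μ)` on `ℝ^q`. -/
def trendMap (z : Fin p → ℝ) (v : Fin q → ℝ) : Fin p → ℝ :=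
  M.chiInv αp θ (M.psi αp z + v, -μ)

/-- The map `u ↦ χ⁻¹ (ψ (z) + α_⊥ᵀ u, -μ)` on `ℝ^p`. -/
def shockMap (z : Fin p → ℝ) (u : Fin p → ℝ) : Fin p → ℝ :=
  M.chiInv αp θ (M.psi αp z + αpᵀ *ᵥ u, -μ)

/-- The matrix `Θ_∞ (z)`, the Jacobian of `u ↦ χ⁻¹ (ψ (z) + α_⊥ᵀ u, -μ)` at `u = 0`. -/
def thetaInf (z : Fin p → ℝ) : Matrix (Fin p) (Fin p) ℝ :=
  jacobian (M.shockMap αp μ θ z) 0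

/-- The set `N` of the steady states `z` for which `v ↦ χ⁻¹ (ψ (z) + v, -μ)` is not differentiable
at `v = 0`. -/
def N : Set (Fin p → ℝ) :=
  {z ∈ M.steadyStates | ¬ DifferentiableAt ℝ (M.trendMap αp μ θ z) 0}

/-- The union `N₀` of `N` and the set of steady states at which the (`p × q`) Jacobian of
`v ↦ χ⁻¹ (ψ (z) + v, -μ)` at `v = 0` is not invertible, that is, not injective as a linear map. -/
def N₀ : Set (Fin p → ℝ) :=
  M.N αp μ θ ∪ {z ∈ M.steadyStates \ M.N αp μ θ |
    ¬ Function.Injective (jacobian (M.trendMap αp μ θ z) 0).mulVec}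

end Multipliers

end NonlinearVAR

end

/-! Write `a` for `boldAlpha k α`, `G` for `M.gradMap θ`, `m` for `(μ, 0)`. In companion form the
model reads `w' = w + a (G w + m) + (u, 0)`. After the last shock the error `x = G w + m` obeys `x'
= (1 + βᵀ a) x` for some `β ∈ ℬ`. If products of such matrices decay geometrically, the increments
of `w` are summable, so `w` converges to a zero of `G + m` (`HasStableGradients.exists_tendsto`). At
this zero the lower block of `G` vanishes, which makes the limit the companion vector of a constant
series `z'` with `θ z' = -μ`. The matrix `P = α_⊥ᵀ [I, -Eᵀ]` annihilates `a`, so `P w` is conserved: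
it equals `α_⊥ᵀ (h̄ s + u)` just after the shock and `ψ z'` in the limit. Hence `z_∞ (u; s) = χ⁻¹
(α_⊥ᵀ h̄ s + α_⊥ᵀ u, -μ)`. It depends on `s` only through `α_⊥ᵀ h̄ s`, and the claims on multipliers
become the chain rule plus surjectivity of `α_⊥ᵀ`.

The map `χ` is onto because the same dynamics can be run towards any target value of `G` at any
value of `P w`. Its inverse is controlled by `HasStableGradients.exists_norm_le`, which bounds `w -
w'` by the differences in `P` and `G`.

The hypothesis bounds eigenvalues of products, whereas decay concerns norms. The bridge is the
Berger–Wang type result `exists_hasGrowthRate_lt_one`. Without decay, some long product keeps a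
normalised orbit between norms `1/2` and `1`. Two points of the orbit are then close, so a
contraction with eigenvalues bounded away from `1` almost fixes a vector, which Cayley–Hamilton
forbids quantitatively. -/

noncomputable section

/-! ### Two facts on seminorms on finite dimensional spaces -/

/-- Volume packing: otherwise the `T` balls of radius `ε / 2` would be disjoint inside the ball of
radius `1 + ε / 2`, giving `T ≤ (1 + 2 / ε) ^ n`. The bound does not depend on the norm, so `T` can
be fixed before the norm is built. -/
theorem Seminorm.exists_lt_sub_lt {ι : Type*} [Fintype ι] (N : Seminorm ℝ (ι → ℝ))
    (hcont : Continuous N) (hlow : ∀ x, ‖x‖ ≤ N x) {ε : ℝ} (hε : 0 < ε) {T : ℕ}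
    (hT : (1 + 2 / ε) ^ Fintype.card ι < T) (y : ℕ → ι → ℝ) (hy : ∀ i, i < T → N (y i) ≤ 1) :
    ∃ i j, i < j ∧ j < T ∧ N (y j - y i) < ε := by
  by_contra! hsep
  set K : Set (ι → ℝ) := N.ball 0 1 with hK
  set vol : MeasureTheory.Measure (ι → ℝ) := MeasureTheory.volume with hvol
  have hopen : ∀ c r, IsOpen (N.ball c r) := fun c r ↦ by
    have : N.ball c r = (fun x ↦ N (x - c)) ⁻¹' Set.Iio r := by ext x; simp [Seminorm.mem_ball]
    rw [this]
    exact isOpen_Iio.preimage (hcont.comp (continuous_id.sub continuous_const))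
  have hball : ∀ (c : ι → ℝ) (r : ℝ), 0 < r →
      vol (N.ball c r) = ENNReal.ofReal (r ^ Fintype.card ι) * vol K := fun c r hr ↦ by
    have h1 : N.ball c r = (fun x ↦ -c + x) ⁻¹' (r • K) := by
      ext x
      rw [Set.mem_preimage, Set.mem_smul_set_iff_inv_smul_mem₀ hr.ne', hK, Seminorm.mem_ball_zero,
        map_smul_eq_mul, Seminorm.mem_ball, neg_add_eq_sub, Real.norm_of_nonneg (by positivity),
        inv_mul_lt_one₀ hr]
    rw [h1, MeasureTheory.measure_preimage_add, MeasureTheory.Measure.addHaar_smul,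
      Module.finrank_pi, abs_of_pos (by positivity)]
  have hKpos : vol K ≠ 0 := (hopen 0 1).measure_ne_zero _ ⟨0, by simp⟩
  have hKtop : vol K ≠ ⊤ := by
    refine ne_top_of_le_ne_top (MeasureTheory.measure_ball_lt_top (x := (0 : ι → ℝ)) (r := 1)).ne
      (MeasureTheory.measure_mono fun x hx ↦ ?_)
    rw [mem_ball_zero_iff]
    exact (hlow x).trans_lt (by simpa [hK, Seminorm.mem_ball] using hx)
  have hdisj : (↑(Finset.range T) : Set ℕ).PairwiseDisjoint fun i ↦ N.ball (y i) (ε / 2) := by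
    have key : ∀ i j, i < j → j < T → Disjoint (N.ball (y i) (ε / 2)) (N.ball (y j) (ε / 2)) := by
      intro i j hij hj
      refine Set.disjoint_left.2 fun x hx hx' ↦ ?_
      rw [Seminorm.mem_ball] at hx hx'
      have h2 : N (y j - y i) ≤ N (x - y i) + N (x - y j) := by
        simpa using map_sub_le_add N (x - y i) (x - y j)
      linarith [hsep i j hij hj]
    intro i hi j hj hij
    rcases lt_or_gt_of_ne hij with h | h
    · exact key i j h (by simpa using hj)
    · exact (key j i h (by simpa using hi)).symm
  have hsub : (⋃ i ∈ Finset.range T, N.ball (y i) (ε / 2)) ⊆ N.ball 0 (1 + ε / 2) := by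
    refine Set.iUnion₂_subset fun i hi x hx ↦ ?_
    rw [Seminorm.mem_ball_zero]
    rw [Seminorm.mem_ball] at hx
    have := map_add_le_add N (x - y i) (y i)
    rw [sub_add_cancel] at this
    linarith [hy i (by simpa using hi)]
  have h3 := MeasureTheory.measure_mono (μ := vol) hsub
  rw [MeasureTheory.measure_biUnion_finset hdisj fun i _ ↦ (hopen _ _).measurableSet,
    Finset.sum_congr rfl fun i _ ↦ hball (y i) (ε / 2) (by positivity),
    hball 0 (1 + ε / 2) (by positivity), Finset.sum_const, Finset.card_range, nsmul_eq_mul,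
    ← mul_assoc, ENNReal.mul_le_mul_iff_left hKpos hKtop, ← ENNReal.ofReal_natCast,
    ← ENNReal.ofReal_mul (by positivity), ENNReal.ofReal_le_ofReal_iff (by positivity)] at h3
  have h4 : 1 + ε / 2 = (ε / 2) * (1 + 2 / ε) := by field_simp; ring
  rw [h4, mul_pow, mul_comm] at h3
  exact absurd (le_of_mul_le_mul_left h3 (by positivity)) (not_le.2 hT)

/-- A contraction with eigenvalues of modulus at most `ρ < 1` cannot almost fix a vector, with a
constant independent of `B` and `N`. For the characteristic polynomial `p`, Cayley–Hamilton gives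
`p(1) x = ∑ p_k (x - B ^ k x)`. Here `|p(1)| = ∏ |1 - λ| ≥ (1 - ρ) ^ n`, the coefficients are
bounded since the roots lie in the unit disc, and `N (x - B ^ k x) ≤ k N (x - B x)` telescopes. -/
theorem Seminorm.mul_le_mul_sub_mulVec {m : Type*} [Fintype m] [DecidableEq m]
    (N : Seminorm ℝ (m → ℝ)) (B : Matrix m m ℝ) (hB : ∀ x, N (B *ᵥ x) ≤ N x) {ρ : ℝ}
    (hρ : ρ ≤ 1) (hspec : ∀ z ∈ spectrum ℂ (B.map (algebraMap ℝ ℂ)), ‖z‖ ≤ ρ) (x : m → ℝ) :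
    (1 - ρ) ^ Fintype.card m * N x ≤
      (∑ k ∈ Finset.range (Fintype.card m + 1),
        ((Fintype.card m).choose (Fintype.card m / 2) : ℝ) * k) * N (x - B *ᵥ x) := by
  set n := Fintype.card m with hn
  set p := B.charpoly with hp
  have hmonic : p.Monic := B.charpoly_monic
  have hdeg : p.natDegree = n := B.charpoly_natDegree_eq_dim
  have hsplit : (p.map (algebraMap ℝ ℂ)).Splits := IsAlgClosed.splits _
  have hroots : ∀ z ∈ (p.map (algebraMap ℝ ℂ)).roots, ‖z‖ ≤ ρ := by
    intro z hz
    refine hspec z ?_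
    rw [Matrix.mem_spectrum_iff_isRoot_charpoly, Matrix.charpoly_map]
    exact (Polynomial.mem_roots'.1 hz).2
  have hcoeff : ∀ k, |p.coeff k| ≤ (n.choose (n / 2) : ℝ) := by
    intro k
    have := Polynomial.coeff_bdd_of_roots_le (B := 1) (algebraMap ℝ ℂ) hmonic hsplit hdeg.le
      (fun z hz ↦ (hroots z hz).trans hρ) k
    simpa using this
  have hpow : ∀ (k : ℕ) (x : m → ℝ), N (x - (B ^ k) *ᵥ x) ≤ k * N (x - B *ᵥ x) := by
    intro k
    induction k with
    | zero => intro x; simp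
    | succ k ih =>
      intro x
      have h1 : x - (B ^ (k + 1)) *ᵥ x = (x - B *ᵥ x) + B *ᵥ (x - (B ^ k) *ᵥ x) := by
        rw [pow_succ', ← Matrix.mulVec_mulVec, Matrix.mulVec_sub]; abel
      rw [h1]
      refine (map_add_le_add N _ _).trans ?_
      have := (hB (x - (B ^ k) *ᵥ x)).trans (ih x)
      push_cast
      linarith
  have heval : (1 - ρ) ^ n ≤ |p.eval 1| := by
    have h1 : ‖(p.map (algebraMap ℝ ℂ)).eval 1‖ = |p.eval 1| := by
      rw [← map_one (algebraMap ℝ ℂ), Polynomial.eval_map_apply]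
      simp
    rw [← h1, hsplit.eval_eq_prod_roots_of_monic (hmonic.map _)]
    have hcard : (p.map (algebraMap ℝ ℂ)).roots.card = n := by
      rw [← hsplit.natDegree_eq_card_roots, Polynomial.natDegree_map, hdeg]
    rw [← hcard]
    clear hcard h1
    generalize (p.map (algebraMap ℝ ℂ)).roots = R at hroots ⊢
    induction R using Multiset.induction_on with
    | empty => simp
    | cons a R ih =>
      simp only [Multiset.card_cons, Multiset.map_cons, Multiset.prod_cons, norm_mul, pow_succ']
      have ha : 1 - ρ ≤ ‖1 - a‖ := by
        have := norm_sub_norm_le (1 : ℂ) a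
        rw [norm_one] at this
        linarith [hroots a (by simp)]
      exact mul_le_mul ha (ih fun z hz ↦ hroots z (by simp [hz])) (pow_nonneg (by linarith) _)
        (norm_nonneg _)
  have hCH : (p.eval 1) • x =
      ∑ k ∈ Finset.range (n + 1), p.coeff k • (x - (B ^ k) *ᵥ x) := by
    have h0 : (∑ k ∈ Finset.range (n + 1), p.coeff k • (B ^ k)) *ᵥ x = 0 := by
      have := B.aeval_self_charpoly
      rw [Polynomial.aeval_eq_sum_range, ← hp, hdeg] at this
      rw [this, Matrix.zero_mulVec]
    simp only [smul_sub, Finset.sum_sub_distrib]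
    rw [Matrix.sum_mulVec] at h0
    simp only [Matrix.smul_mulVec] at h0
    rw [h0, sub_zero, ← Finset.sum_smul, Polynomial.eval_eq_sum_range, hdeg]
    simp
  calc (1 - ρ) ^ n * N x ≤ |p.eval 1| * N x := by gcongr
    _ = N (p.eval 1 • x) := by rw [map_smul_eq_mul, Real.norm_eq_abs]
    _ ≤ ∑ k ∈ Finset.range (n + 1), N (p.coeff k • (x - (B ^ k) *ᵥ x)) := by
      rw [hCH]
      exact Finset.le_sum_of_subadditive N (map_zero N).le (map_add_le_add N) _ _
    _ ≤ ∑ k ∈ Finset.range (n + 1), (n.choose (n / 2) : ℝ) * k * N (x - B *ᵥ x) := by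
      refine Finset.sum_le_sum fun k _ ↦ ?_
      rw [map_smul_eq_mul, Real.norm_eq_abs, mul_assoc]
      exact mul_le_mul (hcoeff k) (hpow k x) (apply_nonneg N _) (by positivity)
    _ = _ := by rw [Finset.sum_mul]
end

noncomputable section

/-! ### Growth of products and the Berger–Wang inequality -/

/-- All `t`-fold products of members of `𝒜` are of size `O(s ^ t)`. -/
def HasGrowthRate {m : Type*} [Fintype m] [DecidableEq m] (𝒜 : Set (Matrix m m ℝ)) (s : ℝ) :
    Prop :=
  ∃ C, 0 ≤ C ∧ ∀ t : ℕ, ∀ B ∈ 𝒜 ^ t, ∀ x : m → ℝ, ‖B *ᵥ x‖ ≤ C * s ^ t * ‖x‖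

variable {m : Type*} [Fintype m] [DecidableEq m]

theorem hasGrowthRate_of_forall_le {𝒜 : Set (Matrix m m ℝ)} {K : ℝ} (hK : 0 ≤ K)
    (h : ∀ A ∈ 𝒜, ∀ x : m → ℝ, ‖A *ᵥ x‖ ≤ K * ‖x‖) : HasGrowthRate 𝒜 K := by
  refine ⟨1, zero_le_one, fun t ↦ ?_⟩
  induction t with
  | zero => intro B hB x; obtain rfl : B = 1 := by simpa using hB
            simp
  | succ t ih =>
    intro B hB x
    rw [pow_succ'] at hB
    obtain ⟨A, hA, B', hB', rfl⟩ := Set.mem_mul.1 hB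
    rw [← Matrix.mulVec_mulVec]
    have h1 := h A hA (B' *ᵥ x)
    have h2 := mul_le_mul_of_nonneg_left (ih B' hB' x) hK
    rw [pow_succ']
    linarith

/-- A norm in which all members of `𝒜` have operator norm at most `s`. -/
theorem HasGrowthRate.exists_seminorm {𝒜 : Set (Matrix m m ℝ)} {s : ℝ} (hs : 0 < s)
    (h : HasGrowthRate 𝒜 s) : ∃ N : Seminorm ℝ (m → ℝ), Continuous N ∧ (∀ x, ‖x‖ ≤ N x) ∧
      (∃ C, 0 ≤ C ∧ ∀ x, N x ≤ C * ‖x‖) ∧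
      ∀ t : ℕ, ∀ B ∈ 𝒜 ^ t, ∀ x, N (B *ᵥ x) ≤ s ^ t * N x := by
  obtain ⟨C, hC, h⟩ := h
  -- The norm is the supremum of `s ^ (-t) ‖B x‖` over all `t` and all `B ∈ 𝒜 ^ t`; the term `t = 0`
  -- makes it dominate `‖x‖`.
  let I := Σ t : ℕ, ↥(𝒜 ^ t)
  let F : I → Seminorm ℝ (m → ℝ) := fun i ↦
    (normSeminorm ℝ (m → ℝ)).comp ((s ^ i.1)⁻¹ • Matrix.mulVecLin i.2.1)
  have hF : ∀ i x, F i x = (s ^ i.1)⁻¹ * ‖i.2.1 *ᵥ x‖ := fun i x ↦ by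
    simp [F, norm_smul, abs_of_pos hs]
  have hFle : ∀ i x, F i x ≤ C * ‖x‖ := fun i x ↦ by
    rw [hF, inv_mul_le_iff₀ (by positivity)]
    linarith [h i.1 i.2.1 i.2.2 x]
  have hbdd' : ∀ x, BddAbove (Set.range fun i ↦ F i x) := fun x ↦
    ⟨C * ‖x‖, by rintro _ ⟨i, rfl⟩; exact hFle i x⟩
  have hbdd : BddAbove (Set.range F) := Seminorm.bddAbove_range_iff.2 hbdd'
  have happ : ∀ x, (⨆ i, F i) x = ⨆ i, F i x := fun x ↦ Seminorm.iSup_apply hbdd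
  have : Nonempty I := ⟨⟨0, 1, by simp⟩⟩
  have hle : ∀ x, (⨆ i, F i) x ≤ C * ‖x‖ := fun x ↦ by
    rw [happ]; exact ciSup_le fun i ↦ hFle i x
  refine ⟨⨆ i, F i, ?_, fun x ↦ ?_, ⟨C, hC, hle⟩, fun t B hB x ↦ ?_⟩
  · refine Seminorm.continuous_of_le (q := (normSeminorm ℝ (m → ℝ)).comp (C • LinearMap.id)) ?_
      fun x ↦ (hle x).trans_eq ?_
    · exact continuous_norm.comp (continuous_const_smul C)
    · simp [norm_smul, abs_of_nonneg hC]
  · rw [happ]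
    refine le_trans (le_of_eq ?_) (le_ciSup (hbdd' x) ⟨0, 1, by simp⟩)
    simp [hF]
  · rw [happ, happ]
    refine ciSup_le fun i ↦ ?_
    have h1 := le_ciSup (hbdd' x) ⟨i.1 + t, i.2.1 * B, by
      rw [pow_add]; exact Set.mul_mem_mul i.2.2 hB⟩
    simp only [hF] at h1 ⊢
    rw [Matrix.mulVec_mulVec]
    rw [inv_mul_le_iff₀ (by positivity)] at h1 ⊢
    rw [pow_add] at h1
    linarith

/-- `P i` is the product of the `i` factors of `B` that act first. -/
theorem exists_trajectory_of_mem_pow {𝒜 : Set (Matrix m m ℝ)} {T : ℕ} {B : Matrix m m ℝ}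
    (hB : B ∈ 𝒜 ^ T) : ∃ P : ℕ → Matrix m m ℝ, P 0 = 1 ∧ P T = B ∧
      ∀ i j, i ≤ j → j ≤ T → ∃ Q ∈ 𝒜 ^ (j - i), P j = Q * P i := by
  induction T generalizing B with
  | zero =>
    refine ⟨fun _ ↦ 1, rfl, by simpa using hB.symm, fun i j hij hj ↦ ⟨1, ?_, by simp⟩⟩
    obtain rfl : j = 0 := by omega
    simp
  | succ T ih =>
    rw [pow_succ'] at hB
    obtain ⟨A, hA, B', hB', rfl⟩ := Set.mem_mul.1 hB
    obtain ⟨P, hP0, hPT, hP⟩ := ih hB'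
    refine ⟨fun i ↦ if i ≤ T then P i else A * B', by simp [hP0], by simp, fun i j hij hj ↦ ?_⟩
    rcases Nat.lt_or_ge T j with hjT | hjT
    · obtain rfl : j = T + 1 := by omega
      rcases Nat.lt_or_ge T i with hiT | hiT
      · obtain rfl : i = T + 1 := by omega
        exact ⟨1, by simp, by simp⟩
      · obtain ⟨Q, hQ, hQ'⟩ := hP i T hiT le_rfl
        refine ⟨A * Q, ?_, ?_⟩
        · rw [Nat.succ_sub hiT, pow_succ']
          exact Set.mul_mem_mul hA hQ
        · simp [hiT, mul_assoc, ← hQ', hPT]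
    · obtain ⟨Q, hQ, hQ'⟩ := hP i j hij hjT
      exact ⟨Q, hQ, by simp [hjT, hij.trans hjT, hQ']⟩

/-- Split `t = T a + r` with `r < T`: the blocks grow at rate `s'`, and the remainder costs at most
the fixed factor `(s / s') ^ T`. -/
theorem hasGrowthRate_of_pow_le {𝒜 : Set (Matrix m m ℝ)} {s s' : ℝ} (hs' : 0 < s') (hss' : s' ≤ s)
    (N : Seminorm ℝ (m → ℝ)) (hlow : ∀ x, ‖x‖ ≤ N x) (hup : ∃ C, 0 ≤ C ∧ ∀ x, N x ≤ C * ‖x‖)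
    (hN : ∀ t : ℕ, ∀ B ∈ 𝒜 ^ t, ∀ x, N (B *ᵥ x) ≤ s ^ t * N x) {T : ℕ} (hT : 0 < T)
    (hNT : ∀ B ∈ 𝒜 ^ T, ∀ x, N (B *ᵥ x) ≤ s' ^ T * N x) : HasGrowthRate 𝒜 s' := by
  have hs : 0 < s := hs'.trans_le hss'
  obtain ⟨C, hC, hup⟩ := hup
  have hmul : ∀ a : ℕ, ∀ B ∈ 𝒜 ^ (T * a), ∀ x, N (B *ᵥ x) ≤ s' ^ (T * a) * N x := by
    intro a
    induction a with
    | zero => intro B hB x; obtain rfl : B = 1 := by simpa using hB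
              simp
    | succ a ih =>
      intro B hB x
      rw [mul_add_one, pow_add] at hB
      obtain ⟨B₁, h₁, B₂, h₂, rfl⟩ := Set.mem_mul.1 hB
      rw [← Matrix.mulVec_mulVec, mul_add_one, pow_add, mul_assoc]
      refine (ih B₁ h₁ _).trans ?_
      have := hNT B₂ h₂ x
      gcongr
  refine ⟨(s / s') ^ T * C, by positivity, fun t B hB x ↦ (hlow _).trans ?_⟩
  have ht : t = T * (t / T) + t % T := (Nat.div_add_mod t T).symm
  have hr : t % T ≤ T := (Nat.mod_lt _ hT).le
  rw [ht, pow_add] at hB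
  obtain ⟨B₁, h₁, B₂, h₂, rfl⟩ := Set.mem_mul.1 hB
  rw [← Matrix.mulVec_mulVec]
  calc N (B₁ *ᵥ B₂ *ᵥ x) ≤ s' ^ (T * (t / T)) * (s ^ (t % T) * N x) := by
        refine (hmul _ B₁ h₁ _).trans ?_
        have := hN _ B₂ h₂ x
        gcongr
    _ = (s / s') ^ (t % T) * s' ^ t * N x := by
        conv_rhs => rw [ht, pow_add]
        rw [Nat.mul_add_mod_self_left, Nat.mod_mod, div_pow]
        field_simp
    _ ≤ (s / s') ^ T * s' ^ t * (C * ‖x‖) := by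
        have h1 : 1 ≤ s / s' := (one_le_div hs').2 hss'
        have := hup x
        gcongr
    _ = _ := by ring

/-- A form of the Berger–Wang theorem: for a bounded set of matrices, a uniform bound below one
for the moduli of the eigenvalues of all products forces the products to decay geometrically. -/
theorem exists_hasGrowthRate_lt_one {𝒜 : Set (Matrix m m ℝ)} {K : ℝ}
    (hbdd : ∀ A ∈ 𝒜, ∀ x : m → ℝ, ‖A *ᵥ x‖ ≤ K * ‖x‖) {ρ : ℝ} (hρ : ρ < 1)
    (hspec : ∀ t : ℕ, 0 < t → ∀ B ∈ 𝒜 ^ t,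
      ∀ z ∈ spectrum ℂ (B.map (algebraMap ℝ ℂ)), ‖z‖ ≤ ρ) :
    ∃ s, 0 < s ∧ s < 1 ∧ HasGrowthRate 𝒜 s := by
  by_contra! hno
  set n := Fintype.card m with hn
  set c : ℝ := ∑ k ∈ Finset.range (n + 1), (n.choose (n / 2) : ℝ) * k with hc
  have hc0 : 0 ≤ c := by positivity
  -- Chosen so that `c ε < (1 - ρ) ^ n / 2`, which contradicts the Cayley–Hamilton bound for a
  -- vector of size at least `1 / 2`.
  set ε : ℝ := (1 - ρ) ^ n / (4 * (c + 1)) with hε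
  have hρ' : 0 < 1 - ρ := by linarith
  have hε0 : 0 < ε := by positivity
  obtain ⟨T, hT⟩ := exists_nat_gt ((1 + 2 / ε) ^ n)
  have hT0 : 0 < T := by
    have : (0 : ℝ) < T := lt_trans (by positivity) hT
    exact_mod_cast this
  set S : Set ℝ := {s | 0 < s ∧ HasGrowthRate 𝒜 s} with hS
  have hSne : S.Nonempty := by
    refine ⟨max K 1, by positivity, hasGrowthRate_of_forall_le (by positivity) fun A hA x ↦ ?_⟩
    exact (hbdd A hA x).trans (by gcongr; exact le_max_left _ _)
  have hS1 : ∀ s ∈ S, 1 ≤ s := fun s hs ↦ by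
    by_contra! h
    exact hno s hs.1 h hs.2
  -- Take `s` just above and `s'` just below the infimum of the growth rates, close enough that `T`
  -- steps at either rate differ by a factor of at most two.
  obtain ⟨s, hsS, s', hs'0, hs's, hs'S, hratio⟩ : ∃ s ∈ S, ∃ s' : ℝ, 0 < s' ∧ s' ≤ s ∧ s' ∉ S ∧
      1 / 2 ≤ (s' / s) ^ T := by
    have hr1 : 1 ≤ sInf S := le_csInf hSne hS1
    have hlim : Tendsto (fun η : ℝ ↦ ((1 - η) / (1 + η)) ^ T) (𝓝[>] 0) (𝓝 1) := by
      have : ContinuousAt (fun η : ℝ ↦ ((1 - η) / (1 + η)) ^ T) 0 := by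
        refine ContinuousAt.pow (ContinuousAt.div ?_ ?_ (by simp)) _ <;> fun_prop
      have h := this.tendsto
      simp only [sub_zero, add_zero, div_one, one_pow] at h
      exact h.mono_left nhdsWithin_le_nhds
    have h1 : ∀ᶠ η : ℝ in 𝓝[>] 0, 1 / 2 ≤ ((1 - η) / (1 + η)) ^ T :=
      hlim.eventually_const_le (by norm_num)
    have h2 : ∀ᶠ η : ℝ in 𝓝[>] 0, η < 1 := (eventually_lt_nhds one_pos).filter_mono nhdsWithin_le_nhds
    obtain ⟨η, ⟨hη, hη1⟩, hη0⟩ := ((h1.and h2).and self_mem_nhdsWithin).exists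
    replace hη0 : 0 < η := hη0
    have hpos : 0 < sInf S := by linarith
    obtain ⟨s, hsS, hs⟩ := exists_lt_of_csInf_lt hSne
      (show sInf S < sInf S * (1 + η) by nlinarith)
    have hs0 : 0 < s := hsS.1
    have hle : sInf S ≤ s := csInf_le ⟨1, fun s hs ↦ hS1 s hs⟩ hsS
    refine ⟨s, hsS, sInf S * (1 - η), by nlinarith, by nlinarith, fun hmem ↦ ?_, hη.trans ?_⟩
    · have := csInf_le ⟨1, fun s hs ↦ hS1 s hs⟩ hmem
      nlinarith
    · have h3 : 0 ≤ (1 - η) / (1 + η) := div_nonneg (by linarith) (by linarith)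
      refine pow_le_pow_left₀ h3 ?_ _
      rw [div_le_div_iff₀ (by linarith) hs0]
      nlinarith
  have hs0 : 0 < s := hsS.1
  have hs1 : 1 ≤ s := hS1 s hsS
  obtain ⟨N, hcont, hlow, hup, hN⟩ := hsS.2.exists_seminorm hs0
  -- Otherwise `s'` would itself be a growth rate.
  obtain ⟨B, hB, x, hx⟩ : ∃ B ∈ 𝒜 ^ T, ∃ x, s' ^ T * N x < N (B *ᵥ x) := by
    by_contra! hcon
    exact hs'S ⟨hs'0, hasGrowthRate_of_pow_le hs'0 hs's N hlow hup hN hT0 hcon⟩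
  have hNx : 0 < N x := by
    refine (apply_nonneg N x).lt_of_ne fun h0 ↦ ?_
    have := hN T B hB x
    rw [← h0] at this hx
    simp only [mul_zero] at this hx
    linarith
  obtain ⟨P, hP0, hPT, hP⟩ := exists_trajectory_of_mem_pow hB
  set y : ℕ → m → ℝ := fun i ↦ ((s ^ i)⁻¹ * (N x)⁻¹) • (P i *ᵥ x) with hy
  have hNy : ∀ i, N (y i) = N (P i *ᵥ x) / (s ^ i * N x) := fun i ↦ by
    rw [hy, map_smul_eq_mul, Real.norm_of_nonneg (by positivity), ← mul_inv, inv_mul_eq_div]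
  have hy1 : ∀ i, i < T → N (y i) ≤ 1 := fun i hi ↦ by
    obtain ⟨Q, hQ, hQ'⟩ := hP 0 i (by omega) hi.le
    rw [hNy, div_le_one (by positivity), hQ', hP0, mul_one]
    exact hN i Q (by simpa using hQ) x
  -- The remaining `T - i` factors expand by at most `s ^ (T - i)`, yet the end point exceeds `s' ^
  -- T N x ≥ s ^ T N x / 2`.
  have hy2 : ∀ i, i < T → 1 / 2 ≤ N (y i) := fun i hi ↦ by
    obtain ⟨Q, hQ, hQ'⟩ := hP i T hi.le le_rfl
    have h1 := hN _ Q hQ (P i *ᵥ x)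
    rw [Matrix.mulVec_mulVec, ← hQ', hPT] at h1
    rw [hNy, le_div_iff₀ (by positivity)]
    have h2 : s ^ T = s ^ (T - i) * s ^ i := by rw [← pow_add, Nat.sub_add_cancel hi.le]
    rw [div_pow, le_div_iff₀ (by positivity), h2] at hratio
    have h3 : s ^ (T - i) * (1 / 2 * (s ^ i * N x)) ≤ s ^ (T - i) * N (P i *ᵥ x) := by
      nlinarith
    exact le_of_mul_le_mul_left h3 (by positivity)
  obtain ⟨i, j, hij, hjT, hclose⟩ := N.exists_lt_sub_lt hcont hlow hε0 hT y hy1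
  obtain ⟨Q, hQ, hQ'⟩ := hP i j hij.le hjT.le
  set a : ℝ := (s ^ (j - i))⁻¹ with ha
  have ha0 : 0 < a := by positivity
  -- This uses `1 ≤ s`: rescaling `Q` to a contraction does not enlarge its eigenvalues.
  have ha1 : a ≤ 1 := inv_le_one_of_one_le₀ (one_le_pow₀ hs1)
  have hQy : (a • Q) *ᵥ y i = y j := by
    have : s ^ j = s ^ (j - i) * s ^ i := by rw [← pow_add, Nat.sub_add_cancel hij.le]
    simp only [hy]
    rw [Matrix.smul_mulVec, Matrix.mulVec_smul, Matrix.mulVec_mulVec, ← hQ', smul_smul, this, ha]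
    congr 1
    field_simp
  have hQN : ∀ x, N ((a • Q) *ᵥ x) ≤ N x := fun x ↦ by
    rw [Matrix.smul_mulVec, map_smul_eq_mul, Real.norm_of_nonneg ha0.le, ha,
      inv_mul_le_iff₀ (by positivity)]
    exact hN _ Q hQ x
  have hQspec : ∀ z ∈ spectrum ℂ ((a • Q).map (algebraMap ℝ ℂ)), ‖z‖ ≤ ρ := by
    intro z hz
    have h1 : (a • Q).map (algebraMap ℝ ℂ) =
        (Units.mk0 (a : ℂ) (by exact_mod_cast ha0.ne')) • Q.map (algebraMap ℝ ℂ) := by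
      ext p q; simp [Units.smul_def]
    rw [h1, spectrum.unit_smul_eq_smul] at hz
    obtain ⟨w, hw, rfl⟩ := hz
    have h2 := hspec (j - i) (by omega) Q hQ w hw
    simp only [Units.val_mk0, norm_smul, Complex.norm_real,
      Real.norm_of_nonneg ha0.le]
    calc a * ‖w‖ ≤ 1 * ‖w‖ := by gcongr
      _ ≤ ρ := by rwa [one_mul]
  have hfin := N.mul_le_mul_sub_mulVec (a • Q) hQN hρ.le hQspec (y i)
  rw [hQy, ← hn, ← hc, map_sub_rev] at hfin
  have h1 : (1 - ρ) ^ n * (1 / 2) ≤ c * ε := by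
    calc (1 - ρ) ^ n * (1 / 2) ≤ (1 - ρ) ^ n * N (y i) := by
          gcongr; exact hy2 i (hij.trans hjT)
      _ ≤ c * N (y j - y i) := hfin
      _ ≤ c * ε := by gcongr
  have h2 : (1 - ρ) ^ n = ε * (4 * (c + 1)) := by rw [hε]; field_simp
  rw [h2] at h1
  nlinarith

/-- Every member of `𝒜 ^ t` has spectral radius at most `ρ ^ t`, where `ρ` is the joint spectral
radius of `𝒜`. -/
theorem norm_le_pow_of_jointSpectralRadius_le {𝒜 : Set (Matrix m m ℝ)} {ρ : ℝ} (hρ0 : 0 ≤ ρ)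
    (h : jointSpectralRadius 𝒜 ≤ ENNReal.ofReal ρ) {t : ℕ} (ht : 0 < t) {B : Matrix m m ℝ}
    (hB : B ∈ 𝒜 ^ t) {z : ℂ} (hz : z ∈ spectrum ℂ (B.map (algebraMap ℝ ℂ))) : ‖z‖ ≤ ρ ^ t := by
  -- The powers of `B` realise `‖z‖ ^ (1 / t)` along the multiples of `t`, which is enough for a
  -- limsup.
  have hfreq : ∃ᶠ T : ℕ in atTop, (‖z‖₊ : ENNReal) ^ (1 / (t : ℝ)) ≤ ⨆ B ∈ 𝒜 ^ T,
      spectralRadius ℂ (B.map (algebraMap ℝ ℂ)) ^ (1 / (T : ℝ)) := by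
    rw [frequently_atTop]
    intro a
    refine ⟨t * (a + 1), by nlinarith, ?_⟩
    have hmem : B ^ (a + 1) ∈ 𝒜 ^ (t * (a + 1)) := by
      rw [pow_mul]; exact Set.pow_mem_pow hB
    refine le_iSup_of_le (B ^ (a + 1)) (le_iSup_of_le hmem ?_)
    have h1 : z ^ (a + 1) ∈ spectrum ℂ ((B ^ (a + 1)).map (algebraMap ℝ ℂ)) := by
      rw [Matrix.map_pow]; exact spectrum.pow_mem_pow _ _ hz
    have h2 : (‖z ^ (a + 1)‖₊ : ENNReal) ≤
        spectralRadius ℂ ((B ^ (a + 1)).map (algebraMap ℝ ℂ)) :=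
      le_iSup_of_le (z ^ (a + 1)) (le_iSup_of_le h1 le_rfl)
    refine le_trans (le_of_eq ?_) (ENNReal.rpow_le_rpow h2 (by positivity))
    rw [nnnorm_pow, ENNReal.coe_pow, ← ENNReal.rpow_natCast, ← ENNReal.rpow_mul]
    congr 1
    push_cast
    field_simp
  have h1 := (le_limsup_of_frequently_le hfreq).trans h
  have h2 := ENNReal.rpow_le_rpow h1 (Nat.cast_nonneg (α := ℝ) t)
  rw [← ENNReal.rpow_mul, one_div_mul_cancel (by positivity), ENNReal.rpow_one,
    ENNReal.rpow_natCast, ← ENNReal.ofReal_pow hρ0, ← enorm_eq_nnnorm, ← ofReal_norm] at h2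
  exact (ENNReal.ofReal_le_ofReal_iff (by positivity)).1 h2

theorem exists_hasGrowthRate_lt_one_of_jointSpectralRadius_le {𝒜 : Set (Matrix m m ℝ)} {K : ℝ}
    (hbdd : ∀ A ∈ 𝒜, ∀ x : m → ℝ, ‖A *ᵥ x‖ ≤ K * ‖x‖) {ρ : ℝ} (hρ0 : 0 ≤ ρ) (hρ : ρ < 1)
    (h : jointSpectralRadius 𝒜 ≤ ENNReal.ofReal ρ) :
    ∃ s, 0 < s ∧ s < 1 ∧ HasGrowthRate 𝒜 s :=
  exists_hasGrowthRate_lt_one hbdd hρ fun _ ht _ hB _ hz ↦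
    (norm_le_pow_of_jointSpectralRadius_le hρ0 h ht hB hz).trans
      (pow_le_of_le_one hρ0 hρ.le ht.ne')

end

noncomputable section

/-! ### Error correction dynamics `w ↦ w + a (G w + m)` -/

theorem Matrix.exists_norm_mulVec_le {I J : Type*} [Fintype I] [Fintype J] (a : Matrix I J ℝ) :
    ∃ K, 0 ≤ K ∧ ∀ x : J → ℝ, ‖a *ᵥ x‖ ≤ K * ‖x‖ :=
  ⟨_, norm_nonneg _, (LinearMap.toContinuousLinearMap a.mulVecLin).le_opNorm⟩

/-- Passes from the Euclidean operator norm to the sup norm through the entries. The factor is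
crude, but only uniform boundedness over `ℬ` is needed. -/
theorem norm_transpose_mulVec_le {I J : Type*} [Fintype I] [Fintype J] [DecidableEq J]
    (β : Matrix I J ℝ) (x : I → ℝ) :
    ‖βᵀ *ᵥ x‖ ≤ Fintype.card I * matrixOpNorm β * ‖x‖ := by
  have h0 : 0 ≤ matrixOpNorm β := norm_nonneg _
  have hentry : ∀ i j, |β i j| ≤ matrixOpNorm β := fun i j ↦ by
    have h1 := (LinearMap.toContinuousLinearMap (Matrix.toEuclideanLin β)).le_opNorm
      (EuclideanSpace.single j 1)
    rw [PiLp.norm_single, norm_one, mul_one] at h1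
    refine le_trans (le_of_eq ?_) ((PiLp.norm_apply_le _ i).trans h1)
    simp [Matrix.toEuclideanLin, Matrix.toLpLin_apply]
  rw [pi_norm_le_iff_of_nonneg (by positivity)]
  intro j
  calc ‖(βᵀ *ᵥ x) j‖ ≤ ∑ i, ‖β i j * x i‖ := norm_sum_le _ _
    _ ≤ ∑ _i : I, matrixOpNorm β * ‖x‖ := by
      refine Finset.sum_le_sum fun i _ ↦ ?_
      rw [norm_mul]
      exact mul_le_mul (hentry i j) (norm_le_pi_norm x i) (norm_nonneg _) h0
    _ = _ := by simp [mul_assoc]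

theorem mulVec_eq_of_tendsto_of_step {I J Q : Type*} [Fintype I] [Fintype J]
    {a : Matrix I J ℝ} {G : (I → ℝ) → J → ℝ} {P : Matrix Q I ℝ} (hPa : P * a = 0) {m : J → ℝ} {w : ℕ → I → ℝ}
    (hw : ∀ n, w (n + 1) = w n + a *ᵥ (G (w n) + m)) {w' : I → ℝ} (h : Tendsto w atTop (𝓝 w')) :
    P *ᵥ w' = P *ᵥ w 0 := by
  have hconst : ∀ n, P *ᵥ w n = P *ᵥ w 0 := by
    intro n
    induction n with
    | zero => rfl
    | succ n ih => rw [hw, Matrix.mulVec_add, Matrix.mulVec_mulVec, hPa, Matrix.zero_mulVec,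
        add_zero, ih]
  have hcont : Continuous fun w ↦ P *ᵥ w := by fun_prop
  have h1 := (hcont.tendsto w').comp h
  refine tendsto_nhds_unique h1 ?_
  simp only [Function.comp_def, hconst]
  exact tendsto_const_nhds

variable {I J Q : Type*} [Fintype I] [Fintype J] [Fintype Q] [DecidableEq J] [DecidableEq Q]

/-- The increments of `G` are given by transposes of members `β` of a bounded set, for which the
products of the matrices `1 + βᵀ a` decay geometrically. -/
structure HasStableGradients (a : Matrix I J ℝ) (G : (I → ℝ) → J → ℝ) (ℬ : Set (Matrix I J ℝ)) :
    Prop where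
  exists_bound : ∃ K, 0 ≤ K ∧ ∀ β ∈ ℬ, ∀ x, ‖βᵀ *ᵥ x‖ ≤ K * ‖x‖
  exists_growthRate : ∃ s, 0 < s ∧ s < 1 ∧ HasGrowthRate ((fun β ↦ 1 + βᵀ * a) '' ℬ) s
  exists_gradient : ∀ w w', ∃ β ∈ ℬ, G w - G w' = βᵀ *ᵥ (w - w')

theorem hasStableGradients_of_jointSpectralRadius_le {a : Matrix I J ℝ} {G : (I → ℝ) → J → ℝ}
    {ℬ : Set (Matrix I J ℝ)} {b ρ : ℝ} (hρ0 : 0 ≤ ρ) (hρ : ρ < 1)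
    (hb : ∀ β ∈ ℬ, matrixOpNorm β ≤ b)
    (hJSR : jointSpectralRadius ((fun β ↦ 1 + βᵀ * a) '' ℬ) ≤ ENNReal.ofReal ρ)
    (hG : ∀ w w', ∃ β ∈ ℬ, G w - G w' = βᵀ *ᵥ (w - w')) : HasStableGradients a G ℬ := by
  have hbound : ∀ β ∈ ℬ, ∀ x, ‖βᵀ *ᵥ x‖ ≤ Fintype.card I * |b| * ‖x‖ := fun β hβ x ↦ by
    refine (norm_transpose_mulVec_le β x).trans ?_
    have := (hb β hβ).trans (le_abs_self b)
    gcongr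
  obtain ⟨Ka, hKa, ha⟩ := a.exists_norm_mulVec_le
  refine ⟨⟨_, by positivity, hbound⟩, ?_, hG⟩
  refine exists_hasGrowthRate_lt_one_of_jointSpectralRadius_le
    (K := 1 + Fintype.card I * |b| * Ka) ?_ hρ0 hρ hJSR
  rintro _ ⟨β, hβ, rfl⟩ x
  rw [Matrix.add_mulVec, Matrix.one_mulVec, ← Matrix.mulVec_mulVec]
  have h1 := hbound β hβ (a *ᵥ x)
  have h2 : Fintype.card I * |b| * ‖a *ᵥ x‖ ≤ Fintype.card I * |b| * (Ka * ‖x‖) := by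
    gcongr; exact ha x
  linarith [norm_add_le x (βᵀ *ᵥ a *ᵥ x)]

/-! ### Convergence, solvability and a Lipschitz bound under stable gradients. -/

namespace HasStableGradients

variable {a : Matrix I J ℝ} {G : (I → ℝ) → J → ℝ} {ℬ : Set (Matrix I J ℝ)}

theorem continuous (h : HasStableGradients a G ℬ) : Continuous G := by
  obtain ⟨K, hK, hbd⟩ := h.exists_bound
  refine LipschitzWith.continuous (K := K.toNNReal) (LipschitzWith.of_dist_le_mul fun w w' ↦ ?_)
  obtain ⟨β, hβ, hw⟩ := h.exists_gradient w w'
  rw [dist_eq_norm, dist_eq_norm, hw, Real.coe_toNNReal K hK]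
  exact hbd β hβ _

theorem exists_tendsto (h : HasStableGradients a G ℬ) {m : J → ℝ} {w : ℕ → I → ℝ}
    (hw : ∀ n, w (n + 1) = w n + a *ᵥ (G (w n) + m)) :
    ∃ w', Tendsto w atTop (𝓝 w') ∧ G w' = -m := by
  obtain ⟨s, hs0, hs1, C, hC, hprod⟩ := h.exists_growthRate
  obtain ⟨Ka, hKa, ha⟩ := a.exists_norm_mulVec_le
  set x : ℕ → J → ℝ := fun n ↦ G (w n) + m with hx
  have hstep : ∀ n, ∃ B ∈ ((fun β : Matrix I J ℝ ↦ 1 + βᵀ * a) '' ℬ) ^ n, x n = B *ᵥ x 0 := by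
    intro n
    induction n with
    | zero => exact ⟨1, by simp, by simp⟩
    | succ n ih =>
      obtain ⟨B, hB, hBx⟩ := ih
      obtain ⟨β, hβ, hβw⟩ := h.exists_gradient (w (n + 1)) (w n)
      refine ⟨(1 + βᵀ * a) * B, ?_, ?_⟩
      · rw [pow_succ']
        exact Set.mul_mem_mul ⟨β, hβ, rfl⟩ hB
      · rw [← Matrix.mulVec_mulVec, ← hBx, Matrix.add_mulVec, Matrix.one_mulVec,
          ← Matrix.mulVec_mulVec]
        have h1 : w (n + 1) - w n = a *ᵥ x n := by rw [hw]; simp [hx]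
        rw [← h1, ← hβw]
        simp only [hx]; abel
  have hxn : ∀ n, ‖x n‖ ≤ C * ‖x 0‖ * s ^ n := fun n ↦ by
    obtain ⟨B, hB, hBx⟩ := hstep n
    rw [hBx]
    linarith [hprod n B hB (x 0)]
  have hx0 : Tendsto x atTop (𝓝 0) := by
    refine squeeze_zero_norm hxn ?_
    simpa using (tendsto_pow_atTop_nhds_zero_of_lt_one hs0.le hs1).const_mul (C * ‖x 0‖)
  have hcauchy : CauchySeq w := by
    refine cauchySeq_of_le_geometric s (Ka * (C * ‖x 0‖)) hs1 fun n ↦ ?_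
    rw [dist_comm, dist_eq_norm, hw, add_sub_cancel_left, mul_assoc]
    exact (ha (x n)).trans (mul_le_mul_of_nonneg_left (hxn n) hKa)
  obtain ⟨w', hw'⟩ := cauchySeq_tendsto_of_complete hcauchy
  refine ⟨w', hw', ?_⟩
  have h1 : Tendsto x atTop (𝓝 (G w' + m)) :=
    ((h.continuous.tendsto w').comp hw').add_const m
  exact eq_neg_of_add_eq_zero_left (tendsto_nhds_unique h1 hx0)

/-- Run the dynamics with `m = -x` from `R v`, where `P` takes the value `v`; the limit solves both
equations. -/
theorem exists_eq (h : HasStableGradients a G ℬ) {P : Matrix Q I ℝ} (hPa : P * a = 0)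
    {R : Matrix I Q ℝ} (hPR : P * R = 1) (v : Q → ℝ) (x : J → ℝ) :
    ∃ w, P *ᵥ w = v ∧ G w = x := by
  let w : ℕ → I → ℝ := fun n ↦ Nat.rec (R *ᵥ v) (fun _ w ↦ w + a *ᵥ (G w + -x)) n
  have hw : ∀ n, w (n + 1) = w n + a *ᵥ (G (w n) + -x) := fun n ↦ rfl
  obtain ⟨w', hw', hG⟩ := h.exists_tendsto hw
  refine ⟨w', ?_, by rw [hG, neg_neg]⟩
  rw [mulVec_eq_of_tendsto_of_step hPa hw hw']
  change P *ᵥ R *ᵥ v = v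
  rw [Matrix.mulVec_mulVec, hPR, Matrix.one_mulVec]

/-- Write `w - w' = R v + a y` with `v = P (w - w')`. A single `β` serves the pair, so `A = 1 + βᵀ
a` satisfies `A y = y + d` with `d` controlled by `v` and `G w - G w'`. The powers of `A` decay
uniformly in `β`, so a Neumann series bounds `y` by `d`. -/
theorem exists_norm_le (h : HasStableGradients a G ℬ) {P : Matrix Q I ℝ}
    (hker : ∀ δ, P *ᵥ δ = 0 → ∃ y, δ = a *ᵥ y) {R : Matrix I Q ℝ} (hPR : P * R = 1) :
    ∃ L, 0 ≤ L ∧ ∀ w w', ‖w - w'‖ ≤ L * (‖P *ᵥ (w - w')‖ + ‖G w - G w'‖) := by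
  obtain ⟨s, hs0, hs1, C, hC, hprod⟩ := h.exists_growthRate
  obtain ⟨Ka, hKa, ha⟩ := a.exists_norm_mulVec_le
  obtain ⟨Kr, hKr, hR⟩ := R.exists_norm_mulVec_le
  obtain ⟨K, hK, hbd⟩ := h.exists_bound
  have hs1' : 0 < 1 - s := by linarith
  refine ⟨Kr + Ka * (C / (1 - s) * (1 + K * Kr)), by positivity, fun w w' ↦ ?_⟩
  obtain ⟨β, hβ, hG⟩ := h.exists_gradient w w'
  set δ := w - w' with hδ
  set v := P *ᵥ δ with hv
  obtain ⟨y, hy⟩ := hker (δ - R *ᵥ v) (by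
    rw [Matrix.mulVec_sub, Matrix.mulVec_mulVec, hPR, Matrix.one_mulVec, sub_self])
  set A : Matrix J J ℝ := 1 + βᵀ * a with hA
  set d := (G w - G w') - βᵀ *ᵥ R *ᵥ v with hd
  have hdy : A *ᵥ y = y + d := by
    rw [hA, Matrix.add_mulVec, Matrix.one_mulVec, ← Matrix.mulVec_mulVec, ← hy, hd, hG,
      Matrix.mulVec_sub]
  have hApow : ∀ n x, ‖(A ^ n) *ᵥ x‖ ≤ C * s ^ n * ‖x‖ := fun n x ↦
    hprod n _ (Set.pow_mem_pow ⟨β, hβ, rfl⟩) x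
  have hiter : ∀ n, y = (A ^ n) *ᵥ y - ∑ i ∈ Finset.range n, (A ^ i) *ᵥ d := by
    intro n
    induction n with
    | zero => simp
    | succ n ih =>
      rw [Finset.sum_range_succ, pow_succ, ← Matrix.mulVec_mulVec, hdy, Matrix.mulVec_add]
      nth_rewrite 1 [ih]
      abel
  have hyd : ‖y‖ ≤ C / (1 - s) * ‖d‖ := by
    have hle : ∀ n : ℕ, ‖y‖ ≤ C * s ^ n * ‖y‖ + C / (1 - s) * ‖d‖ := by
      intro n
      have h1 : ∑ i ∈ Finset.range n, ‖(A ^ i) *ᵥ d‖ ≤ C / (1 - s) * ‖d‖ := by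
        calc ∑ i ∈ Finset.range n, ‖(A ^ i) *ᵥ d‖
            ≤ ∑ i ∈ Finset.range n, C * s ^ i * ‖d‖ := Finset.sum_le_sum fun i _ ↦ hApow i d
          _ = C * (∑ i ∈ Finset.range n, s ^ i) * ‖d‖ := by rw [← Finset.sum_mul, ← Finset.mul_sum]
          _ ≤ C * (1 - s)⁻¹ * ‖d‖ := by
            gcongr
            rw [← tsum_geometric_of_lt_one hs0.le hs1]
            exact (summable_geometric_of_lt_one hs0.le hs1).sum_le_tsum _ fun i _ ↦ by positivity
          _ = _ := by rw [div_eq_mul_inv]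
      calc ‖y‖ = ‖(A ^ n) *ᵥ y - ∑ i ∈ Finset.range n, (A ^ i) *ᵥ d‖ := by rw [← hiter n]
        _ ≤ ‖(A ^ n) *ᵥ y‖ + ‖∑ i ∈ Finset.range n, (A ^ i) *ᵥ d‖ := norm_sub_le _ _
        _ ≤ _ := add_le_add (hApow n y) ((norm_sum_le _ _).trans h1)
    refine ge_of_tendsto' (f := fun n : ℕ ↦ C * s ^ n * ‖y‖ + C / (1 - s) * ‖d‖) (x := atTop) ?_ hle
    have h1 := (((tendsto_pow_atTop_nhds_zero_of_lt_one hs0.le hs1).const_mul C).mul_const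
      ‖y‖).add_const (C / (1 - s) * ‖d‖)
    simpa using h1
  have hdle : ‖d‖ ≤ (1 + K * Kr) * (‖v‖ + ‖G w - G w'‖) := by
    have h1 : ‖βᵀ *ᵥ R *ᵥ v‖ ≤ K * (Kr * ‖v‖) := (hbd β hβ _).trans (by gcongr; exact hR v)
    have h2 := norm_sub_le (G w - G w') (βᵀ *ᵥ R *ᵥ v)
    have h3 : 0 ≤ K * Kr * ‖G w - G w'‖ := by positivity
    nlinarith [norm_nonneg v]
  calc ‖δ‖ = ‖R *ᵥ v + a *ᵥ y‖ := by rw [← hy]; abel_nf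
    _ ≤ ‖R *ᵥ v‖ + ‖a *ᵥ y‖ := norm_add_le _ _
    _ ≤ Kr * (‖v‖ + ‖G w - G w'‖) +
        Ka * (C / (1 - s) * ((1 + K * Kr) * (‖v‖ + ‖G w - G w'‖))) := by
      refine add_le_add ((hR v).trans ?_) ((ha y).trans ?_)
      · gcongr
        linarith [norm_nonneg (G w - G w')]
      · refine mul_le_mul_of_nonneg_left (hyd.trans ?_) hKa
        exact mul_le_mul_of_nonneg_left hdle (by positivity)
    _ = _ := by ring

end HasStableGradients

end

noncomputable section

/-! ### Orthogonal complements -/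

theorem IsPerp.exists_mul_eq_one {p r q : ℕ} {α : Matrix (Fin p) (Fin r) ℝ}
    {αp : Matrix (Fin p) (Fin q) ℝ} (h : IsPerp α αp) : ∃ R : Matrix (Fin p) (Fin q) ℝ, αpᵀ * R = 1 := by
  rw [← Matrix.mulVec_surjective_iff_exists_right_inverse]
  have h1 : Module.finrank ℝ (LinearMap.range αpᵀ.mulVecLin) = q := by
    have := αp.rank_transpose
    rw [h.rank_eq] at this
    exact this
  have h2 : LinearMap.range αpᵀ.mulVecLin = ⊤ :=
    Submodule.eq_top_of_finrank_eq (by rw [h1]; simp)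
  exact LinearMap.range_eq_top.1 h2

theorem IsPerp.exists_eq_mulVec {p r q : ℕ} {α : Matrix (Fin p) (Fin r) ℝ}
    {αp : Matrix (Fin p) (Fin q) ℝ} (h : IsPerp α αp) (hα : α.rank = r) {x : Fin p → ℝ}
    (hx : αpᵀ *ᵥ x = 0) : ∃ v, x = α *ᵥ v := by
  have hle : LinearMap.range α.mulVecLin ≤ LinearMap.ker αpᵀ.mulVecLin := by
    rintro _ ⟨v, rfl⟩
    rw [LinearMap.mem_ker, Matrix.mulVecLin_apply, Matrix.mulVecLin_apply, Matrix.mulVec_mulVec,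
      h.orthogonal, Matrix.zero_mulVec]
  have h1 : Module.finrank ℝ (LinearMap.range αpᵀ.mulVecLin) = q := by
    have := αp.rank_transpose
    rw [h.rank_eq] at this
    exact this
  have h2 : Module.finrank ℝ (LinearMap.range α.mulVecLin) = r := hα
  have h3 := LinearMap.finrank_range_add_finrank_ker αpᵀ.mulVecLin
  rw [h1, Module.finrank_fin_fun] at h3
  have heq := Submodule.eq_of_le_of_finrank_eq hle (by have := h.dim; omega)
  have hmem : x ∈ LinearMap.range α.mulVecLin := by rw [heq]; exact hx
  obtain ⟨v, hv⟩ := hmem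
  exact ⟨v, hv.symm⟩

theorem Matrix.mulVec_injective_of_rank_eq {p r : ℕ} {α : Matrix (Fin p) (Fin r) ℝ}
    (hα : α.rank = r) : Function.Injective α.mulVec := by
  have h2 : Module.finrank ℝ (LinearMap.range α.mulVecLin) = r := hα
  have h3 := LinearMap.finrank_range_add_finrank_ker α.mulVecLin
  rw [h2, Module.finrank_fin_fun] at h3
  have h4 : LinearMap.ker α.mulVecLin = ⊥ := Submodule.finrank_eq_zero.1 (by omega)
  exact LinearMap.ker_eq_bot.1 h4

namespace NonlinearVAR

/-! ### The companion form -/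

section Blocks

variable {p k r q : ℕ}

/-- The matrix `α_⊥ᵀ [I, -Eᵀ]`. -/
def trendMatrix (k : ℕ) {p q : ℕ} (αp : Matrix (Fin p) (Fin q) ℝ) :
    Matrix (Fin q) (Fin p ⊕ (Fin (k - 1) × Fin p)) ℝ :=
  Matrix.fromCols αpᵀ (-(αpᵀ * ET p k))

theorem trendMatrix_mulVec (αp : Matrix (Fin p) (Fin q) ℝ)
    (w : Fin p ⊕ (Fin (k - 1) × Fin p) → ℝ) :
    trendMatrix k αp *ᵥ w = αpᵀ *ᵥ (w ∘ Sum.inl - ET p k *ᵥ (w ∘ Sum.inr)) := by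
  rw [trendMatrix, Matrix.fromCols_mulVec, Matrix.neg_mulVec, Matrix.mulVec_sub,
    Matrix.mulVec_mulVec, sub_eq_add_neg]

theorem boldAlpha_mulVec (α : Matrix (Fin p) (Fin r) ℝ) (x : Fin r → ℝ)
    (y : Fin (k - 1) × Fin p → ℝ) :
    boldAlpha k α *ᵥ Sum.elim x y = Sum.elim (α *ᵥ x + ET p k *ᵥ y) y := by
  simp [boldAlpha, Matrix.fromBlocks_mulVec]

theorem trendMatrix_mul_boldAlpha {α : Matrix (Fin p) (Fin r) ℝ} {αp : Matrix (Fin p) (Fin q) ℝ}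
    (h : αpᵀ * α = 0) : trendMatrix k αp * boldAlpha k α = 0 := by
  simp [trendMatrix, boldAlpha, Matrix.fromCols_mul_fromBlocks, h]

/-- The lower block of `y` must be that of `δ`; what is left of the upper block lies in the kernel
of `α_⊥ᵀ`, which is the range of `α` by a dimension count. -/
theorem exists_eq_boldAlpha_mulVec {α : Matrix (Fin p) (Fin r) ℝ} {αp : Matrix (Fin p) (Fin q) ℝ}
    (h : IsPerp α αp) (hα : α.rank = r) {δ : Fin p ⊕ (Fin (k - 1) × Fin p) → ℝ}
    (hδ : trendMatrix k αp *ᵥ δ = 0) : ∃ y, δ = boldAlpha k α *ᵥ y := by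
  rw [trendMatrix_mulVec] at hδ
  obtain ⟨v, hv⟩ := h.exists_eq_mulVec hα hδ
  refine ⟨Sum.elim v (δ ∘ Sum.inr), ?_⟩
  rw [boldAlpha_mulVec, ← hv, sub_add_cancel, Sum.elim_comp_inl_inr]

theorem exists_trendMatrix_mul_eq_one {α : Matrix (Fin p) (Fin r) ℝ}
    {αp : Matrix (Fin p) (Fin q) ℝ} (h : IsPerp α αp) :
    ∃ R : Matrix (Fin p ⊕ (Fin (k - 1) × Fin p)) (Fin q) ℝ, trendMatrix k αp * R = 1 := by
  obtain ⟨R, hR⟩ := h.exists_mul_eq_one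
  exact ⟨Matrix.fromRows R 0, by simp [trendMatrix, Matrix.fromCols_mul_fromRows, hR]⟩

theorem D_mulVec (ζ : Fin (k - 1) × Fin p → ℝ) (j : Fin (k - 1)) (a : Fin p) :
    (D p k *ᵥ ζ) (j, a) =
      -ζ (j, a) + if h : (j : ℕ) + 1 < k - 1 then ζ (⟨j + 1, h⟩, a) else 0 := by
  have h1 : (D p k *ᵥ ζ) (j, a) = ∑ l : Fin (k - 1), (if l = j then -1 else
      if (l : ℕ) = (j : ℕ) + 1 then 1 else 0) * ζ (l, a) := by
    simp only [Matrix.mulVec, dotProduct, D, Matrix.of_apply, Fintype.sum_prod_type]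
    refine Finset.sum_congr rfl fun l _ ↦ ?_
    simp [ite_mul]
  have h2 : ∀ l : Fin (k - 1), (if l = j then (-1 : ℝ) else
      if (l : ℕ) = (j : ℕ) + 1 then 1 else 0) * ζ (l, a) =
      (if l = j then -ζ (l, a) else 0) + if (l : ℕ) = (j : ℕ) + 1 then ζ (l, a) else 0 := by
    intro l
    by_cases hl : l = j
    · subst hl; simp
    · simp [hl]
  rw [h1, Finset.sum_congr rfl fun l _ ↦ h2 l, Finset.sum_add_distrib]
  congr 1
  · simp
  · split_ifs with h
    · have : ∀ l : Fin (k - 1), ((l : ℕ) = (j : ℕ) + 1) = (l = ⟨j + 1, h⟩) := fun l ↦ by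
        rw [Fin.ext_iff]
      simp [this]
    · refine Finset.sum_eq_zero fun l _ ↦ if_neg ?_
      omega

theorem ET_mulVec (ζ : Fin (k - 1) × Fin p → ℝ) (a : Fin p) :
    (ET p k *ᵥ ζ) a = if h : 0 < k - 1 then ζ (⟨0, h⟩, a) else 0 := by
  have h1 : (ET p k *ᵥ ζ) a = ∑ l : Fin (k - 1), if (l : ℕ) = 0 then ζ (l, a) else 0 := by
    simp only [Matrix.mulVec, dotProduct, ET, Matrix.of_apply, Fintype.sum_prod_type]
    refine Finset.sum_congr rfl fun l _ ↦ ?_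
    by_cases hl : (l : ℕ) = 0 <;> simp [hl]
  rw [h1]
  split_ifs with h
  · have : ∀ l : Fin (k - 1), ((l : ℕ) = 0) = (l = ⟨0, h⟩) := fun l ↦ by rw [Fin.ext_iff]
    simp [this]
  · refine Finset.sum_eq_zero fun l _ ↦ ?_
    have := l.2
    omega

/-- `D` is block triangular with `-I` on the diagonal, so the blocks vanish one after another from
the last one upwards. -/
theorem D_mulVec_injective {ζ : Fin (k - 1) × Fin p → ℝ} (h : D p k *ᵥ ζ = 0) : ζ = 0 := by
  have key : ∀ n : ℕ, ∀ j : Fin (k - 1), k - 1 - (j : ℕ) ≤ n → ∀ a, ζ (j, a) = 0 := by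
    intro n
    induction n with
    | zero => intro j hj; omega
    | succ n ih =>
      intro j hj a
      have h1 := congrFun h (j, a)
      rw [D_mulVec] at h1
      split_ifs at h1 with hlt
      · rw [ih ⟨j + 1, hlt⟩ (by simp only; omega) a] at h1
        simpa using h1
      · simpa using h1
  ext ⟨j, a⟩
  exact key _ j le_rfl a

end Blocks

/-! ### Summation by parts and the companion recursion. -/

variable {p k r q : ℕ} (M : NonlinearVAR p k)

theorem g_eq_add {i : ℕ} (hi : i < k) (z : Fin p → ℝ) :
    M.g i z = M.g (i + 1) z - M.f ⟨i + 1, by omega⟩ z := by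
  have h1 : Finset.univ.filter (fun l : Fin (k + 1) ↦ i < (l : ℕ)) =
      insert ⟨i + 1, by omega⟩ (Finset.univ.filter fun l : Fin (k + 1) ↦ i + 1 < (l : ℕ)) := by
    ext l
    simp only [Finset.mem_filter, Finset.mem_univ, true_and, Finset.mem_insert, Fin.ext_iff]
    omega
  rw [g, g, h1, Finset.sum_insert (by simp)]
  abel

theorem g_self (z : Fin p → ℝ) : M.g k z = 0 := by
  rw [g, neg_eq_zero]
  refine Finset.sum_eq_zero fun l hl ↦ ?_
  have := l.2
  simp only [Finset.mem_filter, Finset.mem_univ, true_and] at hl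
  omega

theorem g_zero (z : Fin p → ℝ) : M.g 0 z = -(M.f 0 z + M.piMap z) := by
  have h1 : Finset.univ.filter (fun l : Fin (k + 1) ↦ 0 < (l : ℕ)) =
      Finset.univ.map (Fin.succEmb k) := by
    ext l
    simp only [Finset.mem_filter, Finset.mem_univ, true_and, Finset.mem_map]
    exact ⟨fun hl ↦ ⟨l.pred (by rintro rfl; simp at hl), by simp⟩, by rintro ⟨y, rfl⟩; simp⟩
  rw [g, h1, Finset.sum_map, piMap]
  simp

/-- Abel summation with `f_i = g_i - g_{i-1}`; the boundary terms are `g_k = 0` and `g_0 = -(f_0 +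
π)`. -/
theorem sum_f_eq [NeZero k] (x : ℕ → Fin p → ℝ) :
    ∑ i : Fin k, M.f i.succ (x i) = M.f 0 (x 0) + M.piMap (x 0) +
      (∑ i : Fin (k - 1), M.g ((i : ℕ) + 1) (x i) -
        ∑ i : Fin (k - 1), M.g ((i : ℕ) + 1) (x (i + 1))) := by
  obtain ⟨K, rfl⟩ : ∃ K, k = K + 1 := ⟨k - 1, by have := NeZero.pos k; omega⟩
  have h1 : ∀ i : Fin (K + 1), M.f i.succ (x i) = M.g (i + 1) (x i) - M.g i (x i) := fun i ↦ by
    rw [M.g_eq_add i.2]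
    have : (⟨(i : ℕ) + 1, by omega⟩ : Fin (K + 1 + 1)) = i.succ := rfl
    rw [this]; abel
  rw [Finset.sum_congr rfl fun i _ ↦ h1 i, Finset.sum_sub_distrib, Fin.sum_univ_castSucc]
  rw [Fin.sum_univ_succ (f := fun i : Fin (K + 1) ↦ M.g i (x i))]
  simp only [Fin.val_castSucc, Fin.val_last, Fin.val_succ, Fin.val_zero, M.g_self, M.g_zero]
  change _ = _ + (∑ i : Fin K, M.g ((i : ℕ) + 1) (x i) - ∑ i : Fin K, M.g ((i : ℕ) + 1) (x (i + 1)))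
  abel

/-- The lower block of the companion vector of the series whose values are, latest first,
`x 0, x 1, …`. -/
def companionTail (x : ℕ → Fin p → ℝ) : Fin (k - 1) × Fin p → ℝ := fun j ↦
  ∑ i : Fin (k - 1), if j.1 ≤ i then M.g ((i : ℕ) + 1) (x (i - j.1 + 1)) j.2 else 0

/-- The companion vector of the series whose values are, latest first, `x 0, x 1, …`. -/
def companion (x : ℕ → Fin p → ℝ) : Fin p ⊕ (Fin (k - 1) × Fin p) → ℝ :=
  Sum.elim (M.f 0 (x 0)) (M.companionTail x)

theorem companionTail_step {x x' : ℕ → Fin p → ℝ} (h : ∀ n, x' (n + 1) = x n) :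
    M.companionTail x' = M.companionTail x +
      ((fun j ↦ M.g ((j.1 : ℕ) + 1) (x 0) j.2) + D p k *ᵥ M.companionTail x) := by
  ext ⟨j, a⟩
  simp only [Pi.add_apply, D_mulVec]
  have h1 : M.companionTail x' (j, a) = M.g (j + 1) (x 0) a +
      if h : (j : ℕ) + 1 < k - 1 then M.companionTail x (⟨j + 1, h⟩, a) else 0 := by
    -- The term `i = j` meets the value that was newest before the step; the terms `i > j` form
    -- block `j + 1` of the old vector. Truncated subtraction is harmless, as the terms `i < j` are
    -- zero.
    have h2 : ∀ i : Fin (k - 1), (if j ≤ i then M.g ((i : ℕ) + 1) (x' (i - j + 1)) a else 0) =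
        (if i = j then M.g ((i : ℕ) + 1) (x 0) a else 0) +
          if (j : ℕ) + 1 ≤ i then M.g ((i : ℕ) + 1) (x (i - (j + 1) + 1)) a else 0 := by
      intro i
      rw [h]
      rcases lt_trichotomy i j with hij | rfl | hij
      · rw [if_neg (not_le.2 hij), if_neg hij.ne, if_neg (by omega), add_zero]
      · simp
      · rw [if_pos hij.le, if_neg hij.ne', if_pos (by omega), zero_add]
        congr 2
        have : (j : ℕ) < i := hij
        omega
    simp only [companionTail]
    rw [Finset.sum_congr rfl fun i _ ↦ h2 i, Finset.sum_add_distrib]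
    congr 1
    · simp
    · split_ifs with hlt
      · rfl
      · refine Finset.sum_eq_zero fun i _ ↦ if_neg ?_
        omega
  rw [h1]
  ring

theorem ET_mulVec_companionTail (x : ℕ → Fin p → ℝ) :
    ET p k *ᵥ M.companionTail x = ∑ i : Fin (k - 1), M.g ((i : ℕ) + 1) (x (i + 1)) := by
  ext a
  rw [ET_mulVec, Finset.sum_apply]
  split_ifs with h
  · simp [companionTail, Fin.le_def]
  · refine (Finset.sum_eq_zero fun i _ ↦ ?_).symm
    have := i.2
    omega

theorem gradMap_elim {θ : (Fin p → ℝ) → Fin r → ℝ} (hf : Function.Injective (M.f 0))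
    (z : Fin p → ℝ) (ζ : Fin (k - 1) × Fin p → ℝ) :
    M.gradMap θ (Sum.elim (M.f 0 z) ζ) =
      Sum.elim (θ z) ((fun j ↦ M.g ((j.1 : ℕ) + 1) z j.2) + D p k *ᵥ ζ) := by
  have h1 : Function.invFun (M.f 0) (M.f 0 z) = z := Function.leftInverse_invFun hf z
  ext (i | i) <;> simp [gradMap, boldTheta, D₀, Matrix.fromBlocks_mulVec, h1]

/-- The equation of motion of the companion vector. -/
theorem companion_step [NeZero k] {α : Matrix (Fin p) (Fin r) ℝ} {b ρ : ℝ} {μ : Fin r → ℝ}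
    {θ : (Fin p → ℝ) → Fin r → ℝ} (hM : M.MemClass α b ρ μ θ) {x x' : ℕ → Fin p → ℝ}
    (h : ∀ n, x' (n + 1) = x n) {u : Fin p → ℝ}
    (hx' : M.f 0 (x' 0) = M.c + ∑ i : Fin k, M.f i.succ (x i) + u) :
    M.companion x' = M.companion x +
      boldAlpha k α *ᵥ (M.gradMap θ (M.companion x) + Sum.elim μ 0) + Sum.elim u 0 := by
  have h1 : M.gradMap θ (M.companion x) + Sum.elim μ 0 = Sum.elim (θ (x 0) + μ)
      ((fun j ↦ M.g ((j.1 : ℕ) + 1) (x 0) j.2) + D p k *ᵥ M.companionTail x) := by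
    rw [companion, M.gradMap_elim hM.homeo.injective]
    ext (i | i) <;> simp
  have h2 := M.companionTail_step h
  -- The lower block of `G` is the increment of the tail, so its image under `Eᵀ` is the difference
  -- of sums in `sum_f_eq`.
  have h3 : (fun j ↦ M.g ((j.1 : ℕ) + 1) (x 0) j.2) + D p k *ᵥ M.companionTail x =
      M.companionTail x' - M.companionTail x := by rw [h2]; abel
  rw [h1, boldAlpha_mulVec, h3, Matrix.mulVec_sub, ET_mulVec_companionTail,
    ET_mulVec_companionTail]
  simp only [h]
  have h4 : M.f 0 (x' 0) = M.f 0 (x 0) + (α *ᵥ (θ (x 0) + μ) +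
      (∑ i : Fin (k - 1), M.g ((i : ℕ) + 1) (x i) -
        ∑ i : Fin (k - 1), M.g ((i : ℕ) + 1) (x (i + 1)))) + u := by
    rw [hx', M.sum_f_eq, hM.const_eq, hM.pi_eq, Matrix.mulVec_add]
    abel
  ext (i | i)
  · simp only [companion, Sum.elim_inl, Pi.add_apply, h4]
  · simp [companion]

theorem trendMatrix_mulVec_companion (αp : Matrix (Fin p) (Fin q) ℝ) (x : ℕ → Fin p → ℝ) :
    trendMatrix k αp *ᵥ M.companion x =
      αpᵀ *ᵥ (M.f 0 (x 0) - ∑ i : Fin (k - 1), M.g ((i : ℕ) + 1) (x (i + 1))) := by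
  rw [trendMatrix_mulVec, companion, Sum.elim_comp_inl, Sum.elim_comp_inr,
    ET_mulVec_companionTail]

/-- For a constant series the tail does not move, so its increment, the lower block of `G`, is zero.
-/
theorem gradMap_companion_const {θ : (Fin p → ℝ) → Fin r → ℝ} (hf : Function.Injective (M.f 0))
    (z : Fin p → ℝ) : M.gradMap θ (M.companion fun _ ↦ z) = Sum.elim (θ z) 0 := by
  have h1 := M.companionTail_step (x := fun _ ↦ z) (x' := fun _ ↦ z) fun _ ↦ rfl
  rw [companion, M.gradMap_elim hf, left_eq_add.1 h1]

theorem trendMatrix_mulVec_companion_const (αp : Matrix (Fin p) (Fin q) ℝ) (z : Fin p → ℝ) :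
    trendMatrix k αp *ᵥ (M.companion fun _ ↦ z) = M.psi αp z := by
  rw [trendMatrix_mulVec_companion, psi, h]

/-- A vector at which the lower block of `gradMap` vanishes is the companion vector of a constant
series. -/
theorem eq_companion_const {θ : (Fin p → ℝ) → Fin r → ℝ} (hf : Function.Bijective (M.f 0))
    {w : Fin p ⊕ (Fin (k - 1) × Fin p) → ℝ} {x : Fin r → ℝ}
    (hw : M.gradMap θ w = Sum.elim x 0) : ∃ z, w = M.companion fun _ ↦ z := by
  obtain ⟨z, hz⟩ := hf.2 (w ∘ Sum.inl)
  have hw' : w = Sum.elim (M.f 0 z) (w ∘ Sum.inr) := by rw [hz, Sum.elim_comp_inl_inr]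
  refine ⟨z, ?_⟩
  have h1 := M.gradMap_companion_const (θ := θ) hf.1 z
  rw [companion, M.gradMap_elim hf.1] at h1
  rw [hw', M.gradMap_elim hf.1] at hw
  have h2 := (congrArg (· ∘ Sum.inr) hw).trans (congrArg (· ∘ Sum.inr) h1).symm
  simp only [Sum.elim_comp_inr] at h2
  have h3 := D_mulVec_injective (ζ := w ∘ Sum.inr - M.companionTail fun _ ↦ z) (by
    rw [Matrix.mulVec_sub, add_left_cancel h2, sub_self])
  rw [hw', companion, sub_eq_zero.1 h3]

end NonlinearVAR
end

noncomputable section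

namespace NonlinearVAR

variable {p k r q : ℕ} {M : NonlinearVAR p k} {α : Matrix (Fin p) (Fin r) ℝ}
  {αp : Matrix (Fin p) (Fin q) ℝ} {b ρ : ℝ} {μ : Fin r → ℝ} {θ : (Fin p → ℝ) → Fin r → ℝ}

namespace MemClass

theorem exists_hasStableGradients (hM : M.MemClass α b ρ μ θ) :
    ∃ ℬ, HasStableGradients (boldAlpha k α) (M.gradMap θ) ℬ := by
  obtain ⟨ℬ, -, hb, hJSR, hG⟩ := hM.exists_jsr_le
  exact ⟨ℬ, hasStableGradients_of_jointSpectralRadius_le hM.nonneg hM.lt_one hb hJSR hG⟩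

theorem mem_steadyStates_iff (hM : M.MemClass α b ρ μ θ) {z : Fin p → ℝ} :
    z ∈ M.steadyStates ↔ θ z = -μ := by
  rw [steadyStates, Set.mem_ofPred_eq, hM.pi_eq, hM.const_eq, ← Matrix.mulVec_neg]
  exact (Matrix.mulVec_injective_of_rank_eq hM.rank_eq).eq_iff

/-! ### The map `χ` is a homeomorphism -/

/-- Continuity of `θ` and of the `g_j` is not assumed: it comes from the Lipschitz map `G`,
restricted to `ζ = 0` and composed with `f_0`. -/
theorem continuous_elim (hM : M.MemClass α b ρ μ θ) : Continuous fun z : Fin p → ℝ ↦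
    (Sum.elim (θ z) (fun j ↦ M.g ((j.1 : ℕ) + 1) z j.2) :
      Fin r ⊕ (Fin (k - 1) × Fin p) → ℝ) := by
  obtain ⟨ℬ, h⟩ := hM.exists_hasStableGradients
  have h1 : Continuous fun z : Fin p → ℝ ↦
      (Sum.elim (M.f 0 z) 0 : Fin p ⊕ (Fin (k - 1) × Fin p) → ℝ) := by
    refine continuous_pi ?_
    rintro (i | i)
    · exact (continuous_apply i).comp hM.homeo.continuous
    · exact continuous_const
  have h2 := h.continuous.comp h1
  refine h2.congr fun z ↦ ?_
  rw [Function.comp_apply, M.gradMap_elim hM.homeo.injective, Matrix.mulVec_zero, add_zero]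

theorem continuous_chi (hM : M.MemClass α b ρ μ θ) (αp : Matrix (Fin p) (Fin q) ℝ) :
    Continuous (M.chi αp θ) := by
  have h1 := hM.continuous_elim
  have hθ : Continuous θ := continuous_pi fun i ↦ (continuous_apply (Sum.inl i)).comp h1
  have hg : ∀ j : Fin (k - 1), Continuous (M.g ((j : ℕ) + 1)) := fun j ↦
    continuous_pi fun a ↦ (continuous_apply (Sum.inr (j, a))).comp h1
  have hh : Continuous M.h :=
    hM.homeo.continuous.sub (continuous_finsetSum _ fun j _ ↦ hg j)
  exact (Continuous.matrix_mulVec continuous_const hh).prodMk hθ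

/-- On companion vectors of constant series, `P` and `G` reduce to `ψ` and `θ`, so the Lipschitz
bound for `w` becomes one for `f_0 ∘ χ⁻¹`. -/
theorem exists_norm_f_zero_sub_le (hM : M.MemClass α b ρ μ θ) (hperp : IsPerp α αp) :
    ∃ L, 0 ≤ L ∧ ∀ z z', ‖M.f 0 z - M.f 0 z'‖ ≤ L * ‖M.chi αp θ z - M.chi αp θ z'‖ := by
  obtain ⟨ℬ, h⟩ := hM.exists_hasStableGradients
  obtain ⟨R, hR⟩ := exists_trendMatrix_mul_eq_one (k := k) hperp
  obtain ⟨L, hL, hle⟩ :=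
    h.exists_norm_le (fun δ ↦ exists_eq_boldAlpha_mulVec hperp hM.rank_eq) hR
  refine ⟨L * 2, by positivity, fun z z' ↦ ?_⟩
  have h1 := hle (M.companion fun _ ↦ z) (M.companion fun _ ↦ z')
  have hf := hM.homeo.injective
  rw [Matrix.mulVec_sub, trendMatrix_mulVec_companion_const, trendMatrix_mulVec_companion_const,
    M.gradMap_companion_const hf, M.gradMap_companion_const hf] at h1
  have h2 : ‖M.f 0 z - M.f 0 z'‖ ≤ ‖M.companion (fun _ ↦ z) - M.companion fun _ ↦ z'‖ := by
    rw [pi_norm_le_iff_of_nonneg (norm_nonneg _)]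
    exact fun i ↦ norm_le_pi_norm (M.companion (fun _ ↦ z) - M.companion fun _ ↦ z') (Sum.inl i)
  have h3 : ‖(Sum.elim (θ z) 0 - Sum.elim (θ z') 0 : Fin r ⊕ (Fin (k - 1) × Fin p) → ℝ)‖ ≤
      ‖θ z - θ z'‖ := by
    rw [pi_norm_le_iff_of_nonneg (norm_nonneg _)]
    rintro (i | i)
    · exact norm_le_pi_norm (θ z - θ z') i
    · simp
  have h4 : ‖M.psi αp z - M.psi αp z'‖ ≤ ‖M.chi αp θ z - M.chi αp θ z'‖ :=
    norm_fst_le (M.chi αp θ z - M.chi αp θ z')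
  have h5 : ‖θ z - θ z'‖ ≤ ‖M.chi αp θ z - M.chi αp θ z'‖ :=
    norm_snd_le (M.chi αp θ z - M.chi αp θ z')
  refine h2.trans (h1.trans ?_)
  rw [mul_assoc]
  gcongr
  linarith

theorem chi_injective (hM : M.MemClass α b ρ μ θ) (hperp : IsPerp α αp) :
    Function.Injective (M.chi αp θ) := by
  obtain ⟨L, -, hL⟩ := hM.exists_norm_f_zero_sub_le hperp
  intro z z' hz
  have h1 := hL z z'
  rw [hz, sub_self, norm_zero, mul_zero, norm_le_zero_iff, sub_eq_zero] at h1
  exact hM.homeo.injective h1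

theorem chi_surjective (hM : M.MemClass α b ρ μ θ) (hperp : IsPerp α αp) :
    Function.Surjective (M.chi αp θ) := by
  rintro ⟨v, x⟩
  obtain ⟨ℬ, h⟩ := hM.exists_hasStableGradients
  obtain ⟨R, hR⟩ := exists_trendMatrix_mul_eq_one (k := k) hperp
  obtain ⟨w, hw, hG⟩ := h.exists_eq (trendMatrix_mul_boldAlpha hperp.orthogonal) hR v
    (Sum.elim x 0)
  obtain ⟨z, rfl⟩ := M.eq_companion_const hM.homeo.bijective hG
  rw [trendMatrix_mulVec_companion_const] at hw
  rw [M.gradMap_companion_const hM.homeo.injective] at hG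
  exact ⟨z, Prod.ext hw (congrArg (· ∘ Sum.inl) hG)⟩

theorem chiInv_chi (hM : M.MemClass α b ρ μ θ) (hperp : IsPerp α αp) (z : Fin p → ℝ) :
    M.chiInv αp θ (M.chi αp θ z) = z :=
  Function.leftInverse_invFun (hM.chi_injective hperp) z

theorem chi_chiInv (hM : M.MemClass α b ρ μ θ) (hperp : IsPerp α αp)
    (y : (Fin q → ℝ) × (Fin r → ℝ)) : M.chi αp θ (M.chiInv αp θ y) = y :=
  Function.rightInverse_invFun (hM.chi_surjective hperp) y

theorem isHomeomorph_chi (hM : M.MemClass α b ρ μ θ) (hperp : IsPerp α αp) :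
    IsHomeomorph (M.chi αp θ) := by
  refine isHomeomorph_iff_exists_inverse.2 ⟨hM.continuous_chi αp, M.chiInv αp θ,
    hM.chiInv_chi hperp, hM.chi_chiInv hperp, ?_⟩
  obtain ⟨L, hL0, hL⟩ := hM.exists_norm_f_zero_sub_le hperp
  -- As `f_0` is a homeomorphism, it is enough that `f_0 ∘ χ⁻¹` is continuous.
  rw [hM.homeo.isInducing.continuous_iff]
  refine LipschitzWith.continuous (K := L.toNNReal) (LipschitzWith.of_dist_le_mul fun y y' ↦ ?_)
  have h1 := hL (M.chiInv αp θ y) (M.chiInv αp θ y')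
  rwa [hM.chi_chiInv hperp, hM.chi_chiInv hperp, ← dist_eq_norm, ← dist_eq_norm,
    ← Real.coe_toNNReal L hL0] at h1

end MemClass

/-! ### Responses to a last shock -/

theorem exists_isResponsePath [NeZero k] (hf : Function.Surjective (M.f 0))
    (s : Fin k → Fin p → ℝ) (τ : ℤ) (u : Fin p → ℝ) : ∃ z, M.IsResponsePath s τ u z := by
  choose f' hf' using hf
  -- Values before the initial state are set to `0`; no equation from date `τ` on involves them.
  -- Below, `x t n` is the value at date `τ - 1 + t - n`.
  let x₀ : ℕ → Fin p → ℝ := fun n ↦ if h : n < k then s ⟨n, h⟩ else 0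
  obtain ⟨x, hx₀, hx_succ, hx_zero⟩ : ∃ x : ℕ → ℕ → Fin p → ℝ, x 0 = x₀ ∧
      (∀ t n, x (t + 1) (n + 1) = x t n) ∧ ∀ t, M.f 0 (x (t + 1) 0) =
        M.c + ∑ i : Fin k, M.f i.succ (x t i) + if t = 0 then u else 0 :=
    ⟨fun t ↦ Nat.rec x₀ (fun t x n ↦ Nat.casesOn n
      (f' (M.c + ∑ i : Fin k, M.f i.succ (x i) + if t = 0 then u else 0)) x) t,
      rfl, fun _ _ ↦ rfl, fun _ ↦ hf' _⟩
  let z : ℤ → Fin p → ℝ := fun t ↦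
    if τ - 1 ≤ t then x (t - (τ - 1)).toNat 0 else x 0 (τ - 1 - t).toNat
  have hz : ∀ t n : ℕ, z (τ - 1 + t - n) = x t n := by
    intro t
    induction t with
    | zero =>
      intro n
      rcases Nat.eq_zero_or_pos n with rfl | hn
      · simp [z]
      · simp only [z]
        rw [if_neg (by omega)]
        congr 1
        omega
    | succ t ih =>
      intro n
      rcases n with _ | n
      · simp only [z]
        rw [if_pos (by omega)]
        congr 1
        omega
      · rw [hx_succ, ← ih n]
        congr 1
        push_cast
        ring
  refine ⟨z, fun i ↦ ?_, fun t ht ↦ ?_⟩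
  · have h1 := hz 0 i
    have h2 : τ - ((i : ℕ) + 1 : ℤ) = τ - 1 + (0 : ℕ) - (i : ℕ) := by push_cast; ring
    rw [h2, h1, hx₀]
    exact dif_pos i.2
  · obtain ⟨n, rfl⟩ : ∃ n : ℕ, t = τ + n := ⟨(t - τ).toNat, by omega⟩
    have h1 : z (τ + n) = x (n + 1) 0 := by
      rw [← hz (n + 1) 0]; congr 1; push_cast; ring
    have h2 : ∀ i : Fin k, z (τ + n - ((i : ℕ) + 1 : ℤ)) = x n i := fun i ↦ by
      rw [← hz n i]; congr 1; ring
    rw [FollowsAt, h1, hx_zero]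
    simp only [h2, Pi.single_apply]
    congr 1
    simp

theorem MemClass.tendsto_of_isResponsePath [NeZero k] (hM : M.MemClass α b ρ μ θ)
    (hperp : IsPerp α αp) {s : Fin k → Fin p → ℝ} {τ : ℤ} {u : Fin p → ℝ}
    {z : ℤ → Fin p → ℝ} (hz : M.IsResponsePath s τ u z) :
    Tendsto z atTop (𝓝 (M.chiInv αp θ (αpᵀ *ᵥ M.hBar s + αpᵀ *ᵥ u, -μ))) := by
  obtain ⟨ℬ, hst⟩ := hM.exists_hasStableGradients
  let x : ℤ → ℕ → Fin p → ℝ := fun t n ↦ z (t - n)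
  have hstep : ∀ t, τ ≤ t → M.companion (x t) = M.companion (x (t - 1)) + boldAlpha k α *ᵥ
      (M.gradMap θ (M.companion (x (t - 1))) + Sum.elim μ 0) +
        Sum.elim ((Pi.single τ u : ℤ → Fin p → ℝ) t) 0 := fun t ht ↦ by
    refine M.companion_step hM (fun n ↦ ?_) ?_
    · simp only [x]; congr 1; push_cast; ring
    · have h1 := hz.follows t ht
      rw [FollowsAt] at h1
      simp only [x, Nat.cast_zero, sub_zero]
      rw [h1]
      congr 3 with i
      congr 2
      ring
  -- Started at `τ`, with the shock already absorbed, the recursion is autonomous; the shock remains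
  -- only in the conserved value `P (w 0)`.
  let w : ℕ → Fin p ⊕ (Fin (k - 1) × Fin p) → ℝ := fun n ↦ M.companion (x (τ + n))
  have hw : ∀ n, w (n + 1) = w n + boldAlpha k α *ᵥ (M.gradMap θ (w n) + Sum.elim μ 0) := by
    intro n
    have h1 := hstep (τ + (n + 1 : ℕ)) (by omega)
    have h2 : τ + ((n + 1 : ℕ) : ℤ) - 1 = τ + n := by push_cast; ring
    have h3 : (Pi.single τ u : ℤ → Fin p → ℝ) (τ + (n + 1 : ℕ)) = 0 :=
      Pi.single_eq_of_ne (by omega) _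
    have h4 : (Sum.elim 0 0 : Fin p ⊕ (Fin (k - 1) × Fin p) → ℝ) = 0 := by
      ext (i | i) <;> rfl
    rw [h2, h3, h4, add_zero] at h1
    exact h1
  have hPa := trendMatrix_mul_boldAlpha (k := k) hperp.orthogonal
  have hP0 : trendMatrix k αp *ᵥ w 0 = αpᵀ *ᵥ M.hBar s + αpᵀ *ᵥ u := by
    have h1 := hstep τ le_rfl
    have h2 : w 0 = M.companion (x τ) := by simp [w]
    have h3 : trendMatrix k αp *ᵥ M.companion (x (τ - 1)) = αpᵀ *ᵥ M.hBar s := by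
      rw [trendMatrix_mulVec_companion, hBar]
      congr 2
      · rw [← hz.init 0]
        simp [x]
      · refine Finset.sum_congr rfl fun i _ ↦ ?_
        rw [← hz.init]
        simp only [x]
        congr 2
        push_cast
        ring
    rw [h2, h1, Matrix.mulVec_add, Matrix.mulVec_add, Matrix.mulVec_mulVec, hPa,
      Matrix.zero_mulVec, add_zero, h3, Pi.single_eq_same, trendMatrix_mulVec]
    simp only [Sum.elim_comp_inl, Sum.elim_comp_inr, Matrix.mulVec_zero, sub_zero]
  obtain ⟨w', hw', hG⟩ := hst.exists_tendsto hw
  have hG' : M.gradMap θ w' = Sum.elim (-μ) 0 := by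
    rw [hG]; ext (i | i) <;> simp
  obtain ⟨z', rfl⟩ := M.eq_companion_const hM.homeo.bijective hG'
  have hP := mulVec_eq_of_tendsto_of_step hPa hw hw'
  rw [trendMatrix_mulVec_companion_const, hP0] at hP
  rw [M.gradMap_companion_const hM.homeo.injective] at hG'
  have hθ : θ z' = -μ := congrArg (· ∘ Sum.inl) hG'
  have hz' : M.chiInv αp θ (αpᵀ *ᵥ M.hBar s + αpᵀ *ᵥ u, -μ) = z' := by
    rw [← hP, ← hθ]
    exact hM.chiInv_chi hperp z'
  rw [hz']
  -- The upper block of `w` is `f_0` of the path, and convergence pulls back through the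
  -- homeomorphism `f_0`.
  have hnat : Tendsto (fun n : ℕ ↦ z (τ + n)) atTop (𝓝 z') := by
    rw [hM.homeo.isInducing.tendsto_nhds_iff]
    have h1 : Continuous fun w : Fin p ⊕ (Fin (k - 1) × Fin p) → ℝ ↦ w ∘ Sum.inl :=
      continuous_pi fun i ↦ continuous_apply (Sum.inl i)
    refine ((h1.tendsto _).comp hw').congr fun n ↦ ?_
    simp [w, companion, x]
  have htoNat : Tendsto (fun t : ℤ ↦ (t - τ).toNat) atTop atTop :=
    tendsto_atTop_atTop.2 fun n ↦ ⟨τ + n, fun t ht ↦ by omega⟩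
  refine (hnat.comp htoNat).congr' ?_
  filter_upwards [eventually_ge_atTop τ] with t ht
  simp only [Function.comp_apply]
  congr 1
  omega

/-! ### Long-run multipliers -/

theorem MemClass.hasLongRunMultiplier_iff [NeZero k] (hM : M.MemClass α b ρ μ θ)
    (hperp : IsPerp α αp) {s : Fin k → Fin p → ℝ} {z : Fin p → ℝ}
    (hz : M.psi αp z = αpᵀ *ᵥ M.hBar s) (Θ : Matrix (Fin p) (Fin p) ℝ) :
    M.HasLongRunMultiplier s Θ ↔
      HasFDerivAt (M.shockMap αp μ θ z) (LinearMap.toContinuousLinearMap (Matrix.toLin' Θ)) 0 := by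
  constructor
  · rintro ⟨zInf, hzInf, hder⟩
    have h1 : zInf = M.shockMap αp μ θ z := by
      ext1 u
      obtain ⟨⟨y, hy⟩, hlim⟩ := hzInf u 0
      rw [shockMap, hz]
      exact tendsto_nhds_unique (hlim y hy) (hM.tendsto_of_isResponsePath hperp hy)
    rwa [← h1]
  · refine fun hder ↦ ⟨_, fun u τ ↦ ⟨exists_isResponsePath hM.homeo.surjective s τ u,
      fun y hy ↦ ?_⟩, hder⟩
    rw [shockMap, hz]
    exact hM.tendsto_of_isResponsePath hperp hy

theorem hasFDerivAt_shockMap {z : Fin p → ℝ}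
    (h : DifferentiableAt ℝ (M.trendMap αp μ θ z) 0) :
    HasFDerivAt (M.shockMap αp μ θ z) ((fderiv ℝ (M.trendMap αp μ θ z) 0).comp
      (LinearMap.toContinuousLinearMap (Matrix.toLin' αpᵀ))) 0 := by
  have h1 : HasFDerivAt (M.trendMap αp μ θ z) (fderiv ℝ (M.trendMap αp μ θ z) 0)
      (LinearMap.toContinuousLinearMap (Matrix.toLin' αpᵀ) 0) := by
    rw [map_zero]; exact h.hasFDerivAt
  exact h1.comp 0 (LinearMap.toContinuousLinearMap (Matrix.toLin' αpᵀ)).hasFDerivAt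

theorem thetaInf_eq {z : Fin p → ℝ} (h : DifferentiableAt ℝ (M.trendMap αp μ θ z) 0) :
    M.thetaInf αp μ θ z = jacobian (M.trendMap αp μ θ z) 0 * αpᵀ := by
  rw [thetaInf, jacobian, jacobian, (hasFDerivAt_shockMap h).fderiv]
  apply Matrix.toLin'.injective
  rw [Matrix.toLin'_mul, Matrix.toLin'_toMatrix', Matrix.toLin'_toMatrix']
  rfl

/-- A right inverse `R` of `α_⊥ᵀ` recovers the trend map as the shock map composed with `R`, so
composing with `α_⊥ᵀ` cannot hide a failure of differentiability. -/
theorem differentiableAt_trendMap {α : Matrix (Fin p) (Fin r) ℝ} (hperp : IsPerp α αp)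
    {z : Fin p → ℝ} (h : DifferentiableAt ℝ (M.shockMap αp μ θ z) 0) :
    DifferentiableAt ℝ (M.trendMap αp μ θ z) 0 := by
  obtain ⟨R, hR⟩ := hperp.exists_mul_eq_one
  have h1 : M.trendMap αp μ θ z =
      M.shockMap αp μ θ z ∘ LinearMap.toContinuousLinearMap (Matrix.toLin' R) := by
    ext1 v
    simp only [trendMap, shockMap, Function.comp_apply, LinearMap.coe_toContinuousLinearMap',
      Matrix.toLin'_apply, Matrix.mulVec_mulVec, hR, Matrix.one_mulVec]
  rw [h1]
  refine DifferentiableAt.comp 0 ?_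
    (LinearMap.toContinuousLinearMap (Matrix.toLin' R)).differentiableAt
  rwa [map_zero]

theorem hasFDerivAt_shockMap_iff {α : Matrix (Fin p) (Fin r) ℝ} (hperp : IsPerp α αp)
    {z : Fin p → ℝ} (hz : z ∈ M.steadyStates) (Θ : Matrix (Fin p) (Fin p) ℝ) :
    HasFDerivAt (M.shockMap αp μ θ z) (LinearMap.toContinuousLinearMap (Matrix.toLin' Θ)) 0 ↔
      z ∉ M.N αp μ θ ∧ Θ = M.thetaInf αp μ θ z := by
  constructor
  · intro h
    refine ⟨fun hN ↦ hN.2 (differentiableAt_trendMap hperp h.differentiableAt), ?_⟩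
    rw [thetaInf, jacobian, h.fderiv]
    simp
  · rintro ⟨hN, rfl⟩
    have h1 : DifferentiableAt ℝ (M.trendMap αp μ θ z) 0 := by
      by_contra h
      exact hN ⟨hz, h⟩
    have h2 := (hasFDerivAt_shockMap h1).differentiableAt.hasFDerivAt
    convert h2
    rw [thetaInf, jacobian, Matrix.toLin'_toMatrix']
    rfl

/-- Right multiplication by a right inverse of `α_⊥ᵀ` recovers `A`, so no rank is lost. -/
theorem rank_mul_transpose_eq {α : Matrix (Fin p) (Fin r) ℝ} (hperp : IsPerp α αp)
    {A : Matrix (Fin p) (Fin q) ℝ} (hA : Function.Injective A.mulVec) :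
    (A * αpᵀ).rank = q := by
  obtain ⟨R, hR⟩ := hperp.exists_mul_eq_one
  have h1 : A.rank = q := by
    have h := LinearMap.finrank_range_of_inj (f := A.mulVecLin) hA
    rw [Module.finrank_fin_fun] at h
    exact h
  have h2 : A.rank ≤ (A * αpᵀ).rank := by
    conv_lhs => rw [← Matrix.mul_one A, ← hR, ← Matrix.mul_assoc]
    exact Matrix.rank_mul_le_left _ _
  have h3 := Matrix.rank_mul_le_left A αpᵀ
  omega

end NonlinearVAR

end

/-! ### Assembly of the theorem. -/

theorem mainTheorem4 {p k q r : ℕ} [NeZero k] (M : NonlinearVAR p k)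
    (α : Matrix (Fin p) (Fin r) ℝ) (αp : Matrix (Fin p) (Fin q) ℝ) (hperp : IsPerp α αp)
    (b ρ : ℝ) (μ : Fin r → ℝ) (θ : (Fin p → ℝ) → (Fin r → ℝ)) (hM : M.MemClass α b ρ μ θ) :
    -- the map `χ` is a homeomorphism, so that `χ⁻¹` is well defined
    IsHomeomorph (M.chi αp θ) ∧
    -- the multipliers at a general state are those at a steady state
    (∀ s : Fin k → Fin p → ℝ, ∃ z ∈ M.steadyStates, M.psi αp z = αpᵀ *ᵥ M.hBar s ∧
      ∀ Θ, M.HasLongRunMultiplier s Θ ↔ M.HasLongRunMultiplier (fun _ ↦ z) Θ) ∧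
    -- those at a steady state `z` exist if and only if `z ∉ N`, and are then given by `Θ_∞ (z)`
    (∀ z ∈ M.steadyStates, ∀ Θ, M.HasLongRunMultiplier (fun _ ↦ z) Θ ↔
      z ∉ M.N αp μ θ ∧ Θ = M.thetaInf αp μ θ z) ∧
    -- the full set of long-run multiplier matrices
    {Θ | ∃ s : Fin k → Fin p → ℝ, M.HasLongRunMultiplier s Θ} =
      M.thetaInf αp μ θ '' (M.steadyStates \ M.N αp μ θ) ∧
    -- the two expressions for `Θ_∞ (z)`
    (∀ z ∈ M.steadyStates \ M.N αp μ θ,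
      DifferentiableAt ℝ (M.shockMap αp μ θ z) 0 ∧
      M.thetaInf αp μ θ z = jacobian (M.trendMap αp μ θ z) 0 * αpᵀ) ∧
    -- the rank of `Θ_∞ (z)`
    (∀ z ∈ M.steadyStates \ M.N₀ αp μ θ, (M.thetaInf αp μ θ z).rank = q) := by
  have hconst : ∀ z, M.psi αp z = αpᵀ *ᵥ M.hBar fun _ ↦ z := fun z ↦ rfl
  have hgen : ∀ s : Fin k → Fin p → ℝ, ∃ z ∈ M.steadyStates, M.psi αp z = αpᵀ *ᵥ M.hBar s ∧
      ∀ Θ, M.HasLongRunMultiplier s Θ ↔ M.HasLongRunMultiplier (fun _ ↦ z) Θ := by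
    intro s
    -- The matching steady state is `χ⁻¹ (α_⊥ᵀ h̄ s, -μ)`.
    obtain ⟨z, hz⟩ := hM.chi_surjective hperp (αpᵀ *ᵥ M.hBar s, -μ)
    have hψ : M.psi αp z = αpᵀ *ᵥ M.hBar s := congrArg Prod.fst hz
    refine ⟨z, hM.mem_steadyStates_iff.2 (congrArg Prod.snd hz), hψ, fun Θ ↦ ?_⟩
    rw [hM.hasLongRunMultiplier_iff hperp hψ, hM.hasLongRunMultiplier_iff hperp (hconst z)]
  have hsteady : ∀ z ∈ M.steadyStates, ∀ Θ, M.HasLongRunMultiplier (fun _ ↦ z) Θ ↔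
      z ∉ M.N αp μ θ ∧ Θ = M.thetaInf αp μ θ z := fun z hz Θ ↦ by
    rw [hM.hasLongRunMultiplier_iff hperp (hconst z),
      NonlinearVAR.hasFDerivAt_shockMap_iff hperp hz]
  have hdiff : ∀ z ∈ M.steadyStates \ M.N αp μ θ, DifferentiableAt ℝ (M.trendMap αp μ θ z) 0 :=
    fun z hz ↦ by
      by_contra h
      exact hz.2 ⟨hz.1, h⟩
  refine ⟨hM.isHomeomorph_chi hperp, hgen, hsteady, ?_, fun z hz ↦ ?_, fun z hz ↦ ?_⟩
  · ext Θ
    constructor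
    · rintro ⟨s, hs⟩
      obtain ⟨z, hz, -, hiff⟩ := hgen s
      obtain ⟨hN, rfl⟩ := (hsteady z hz Θ).1 ((hiff Θ).1 hs)
      exact ⟨z, ⟨hz, hN⟩, rfl⟩
    · rintro ⟨z, ⟨hz, hN⟩, rfl⟩
      exact ⟨fun _ ↦ z, (hsteady z hz _).2 ⟨hN, rfl⟩⟩
  · exact ⟨(NonlinearVAR.hasFDerivAt_shockMap (hdiff z hz)).differentiableAt,
      NonlinearVAR.thetaInf_eq (hdiff z hz)⟩
  · have hN : z ∈ M.steadyStates \ M.N αp μ θ := ⟨hz.1, fun h ↦ hz.2 (Or.inl h)⟩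
    rw [NonlinearVAR.thetaInf_eq (hdiff z hN)]
    refine NonlinearVAR.rank_mul_transpose_eq hperp ?_
    by_contra h
    exact hz.2 (Or.inr ⟨hN, h⟩)
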